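/- Identify $[a\ \ b]^\top\in\mathbb R^2$ with $a+jb\in\mathbb C$ and $\left[\begin{smallmatrix}a&-b\\ b&a\end{smallmatrix}\right]$ with multiplication by $a+jb$, so that the Euclidean norm of a vector and the spectral norm of such a matrix are both the modulus. Let $p^\star,q^\star,\varphi,\omega_0,\omega_g,v_g,g_f\in\mathbb R$, $v^\star,\eta,r_g,l_g,c_f,l_f,k_p^v,k_r^v,k_p^c,k_r^c>0$, $\alpha\ge 0$, and put $\omega_\Delta=\omega_0-\omega_g$, $Z=r_g+j\omega_g l_g$, $Y=Z^{-1}$, $Y_f=g_f+j\omega_g c_f$, $S=e^{j\varphi}\frac{p^\star-jq^\star}{v^{\star2}}$. Consider the full-order (twelfth-order) converter system with state $x_1=\hat v$, $x_2=i$, $x_3=(v,\zeta_v)$, $x_4=(i_f,\zeta_c)$, all six components in $\mathbb R^2\cong\mathbb C$: $$\dot{\hat v}=j\omega_\Delta\hat v+\eta S\hat v-\eta e^{j\varphi}i+\eta\alpha\tfrac{v^{\star2}-\|\hat v\|^2}{v^{\star2}}\hat v,\qquad \dot i=l_g^{-1}(-Zi+v-v_g),$$ $$\dot v=c_f^{-1}(-Y_fv-i+i_f),\quad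 \dot\zeta_v=j\omega_\Delta\zeta_v+v-\hat v,\quad \dot i_f=l_f^{-1}\bigl(-k_p^c(i_f-i_f^\star)-k_r^c\zeta_c\bigr),\quad \dot\zeta_c=j\omega_\Delta\zeta_c+i_f-i_f^\star,$$ $$i_f^\star=-k_p^v(v-\hat v)-k_r^v\zeta_v+Y_fv+i .$$ **Theorem.** Let $\omega_\Delta=0$, let $x_{\rm s}$ be an equilibrium point of this system and $v_s$ its $\hat v$-component. Let $c_1>0$ and $\epsilon>3$ and define $c_\epsilon=\|S-e^{j\varphi}Y+\alpha\|+\alpha\epsilon\frac{\|v_s\|^2}{v^{\star2}}$, $c_v=\frac{c_f}{k_p^v}+\frac{c_f}{k_r^v}$, $\alpha_2=1$, $\alpha_3=1-\frac{c_f}{k_r^v}$, $\beta_{12}=1$, $\beta_{23}=\frac1{r_g}$, $\beta_{34}=\frac1{k_p^v}+\frac1{k_r^v}$, $\beta_{21}=c_\epsilon\eta\frac{l_g}{r_g}\|Y\|$, $\gamma_2=\eta\frac{l_g}{r_g}\|Y\|$, $\beta_{31}=c_\epsilon c_v\eta$, $\beta_{32}=c_v\eta$, $\gamma_3=0$, $\tilde\beta_{41}=c_\epsilon\eta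 k_p^v$, $\tilde\beta_{42}=\eta k_p^v+\frac{\|Z\|}{l_g}$, $\tilde\beta_{43}=\frac1{l_g}+\|Y_f-k_p^v\|\frac{k_p^v+k_r^v}{c_f}+k_r^v$, $\tilde\gamma_4=\frac{\|Y_f-k_p^v\|}{c_f}$, and, for $i=2,3$, with $b_2=\beta_{21}^2$ and $b_3=\frac14\beta_{31}^2+\beta_{32}^2$, $$c_i=\tfrac12\Bigl(\alpha_i-\gamma_i+\tfrac{\beta_{i(i-1)}}{\beta_{(i-1)i}}c_{i-1}-\sqrt{D_i}\Bigr),\quad D_i=\Bigl(\alpha_i-\gamma_i+\tfrac{\beta_{i(i-1)}}{\beta_{(i-1)i}}c_{i-1}\Bigr)^2+4\Bigl(b_i-(\alpha_i-\gamma_i)\tfrac{\beta_{i(i-1)}}{\beta_{(i-1)i}}c_{i-1}\Bigr).$$ Assume $$\text{(a)}\quad \Re\Bigl\{e^{j\varphi}\tfrac{p^\star-jq^\star}{v^{\star2}}\Bigr\}+\alpha+c_1<\tfrac12\tfrac{\alpha\|v_s\|^2}{v^{\star2}}+\Re\{e^{j\varphi}Y\},\qquad \text{(b)}\quad 0<\eta<\frac{c_1}{\frac{l_g}{r_g}\|Y\|(c_1+c_\epsilon)},$$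 $$\text{(c)}\quad 0<\frac{1+k_r^v/k_p^v}{k_r^v/c_f-1}<\frac{4c_2}{\frac1{r_g}\eta(c_\epsilon^2+4)},\qquad \text{(d)}\quad 0<\frac{1+k_r^c/k_p^c}{k_r^c/l_f-1}<\frac{4c_3}{\frac{\beta_{34}}{\tilde\beta_{43}}(\tilde\beta_{41}^2+\tilde\beta_{42}^2+4\tilde\beta_{43}^2)+c_3\tilde\gamma_4}.$$ Then the equilibrium point $x_{\rm s}$ is asymptotically stable (Lyapunov stable and locally attractive, solutions starting nearby existing for all $t\ge0$). Moreover, if $v_s\ne0$, there is $r>0$ with $\dfrac{(1+r/\|v_s\|)^3-1}{r/\|v_s\|}=\epsilon$, and the region of attraction of $x_{\rm s}$ contains $\{(x_1,x_2,x_3,x_4):\|x_1-v_s\|<r\}$. -/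

import Mathlib

noncomputable section

open Complex Filter Topology Set

/-! ### Autonomous differential equations on the half-line `[0, ∞)` -/

/-- `x` is a solution of `x' = f(x)` on `[0, ∞)`. -/
def IsForwardSolution {E : Type*} [NormedAddCommGroup E] [NormedSpace ℝ E]
    (f : E → E) (x : ℝ → E) : Prop :=
  ∀ t : ℝ, 0 ≤ t → HasDerivWithinAt x (f (x t)) (Ici 0) t

/-- The region of attraction of `xe`: the initial states from which a solution exists for all
forward time and from which every solution converges to `xe`. -/
def regionOfAttraction {E : Type*} [NormedAddCommGroup E] [NormedSpace ℝ E]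
    (f : E → E) (xe : E) : Set E :=
  {x₀ | (∃ x : ℝ → E, IsForwardSolution f x ∧ x 0 = x₀) ∧
    ∀ x : ℝ → E, IsForwardSolution f x → x 0 = x₀ → Tendsto x atTop (𝓝 xe)}

/-- Lyapunov stability: solutions that start close to `xe` exist for all forward time and stay
close to `xe`. -/
def LyapunovStable {E : Type*} [NormedAddCommGroup E] [NormedSpace ℝ E]
    (f : E → E) (xe : E) : Prop :=
  ∀ ρ : ℝ, 0 < ρ → ∃ δ : ℝ, 0 < δ ∧ ∀ x₀ : E, ‖x₀ - xe‖ < δ →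
    (∃ x : ℝ → E, IsForwardSolution f x ∧ x 0 = x₀) ∧
    ∀ x : ℝ → E, IsForwardSolution f x → x 0 = x₀ → ∀ t : ℝ, 0 ≤ t → ‖x t - xe‖ < ρ

/-- Asymptotic stability of an equilibrium: Lyapunov stability and local attractivity. -/
def AsymptoticallyStable {E : Type*} [NormedAddCommGroup E] [NormedSpace ℝ E]
    (f : E → E) (xe : E) : Prop :=
  f xe = 0 ∧ LyapunovStable f xe ∧ regionOfAttraction f xe ∈ 𝓝 xe

/-! ### The grid-connected converter

A vector `[a b]ᵀ` of `ℝ²` is written as the complex number `a + jb`, and a matrix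
`[a -b; b a]` as multiplication by `a + jb`; the Euclidean norm of the vector and the spectral
norm of the matrix are then both the modulus. -/

/-- Setpoints, gains, and circuit and grid parameters. -/
structure GridConverter where
  /-- active power setpoint -/
  pStar : ℝ
  /-- reactive power setpoint -/
  qStar : ℝ
  /-- voltage setpoint -/
  vStar : ℝ
  /-- rotation angle -/
  φ : ℝ
  /-- power droop gain -/
  η : ℝ
  /-- voltage droop gain -/
  α : ℝ
  /-- nominal frequency -/
  ω₀ : ℝ
  /-- grid frequency -/
  ωg : ℝ
  /-- grid voltage (in the frame oriented along it) -/
  vg : ℝ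
  /-- grid resistance -/
  rg : ℝ
  /-- grid inductance -/
  lg : ℝ
  /-- filter conductance -/
  gf : ℝ
  /-- filter capacitance -/
  cf : ℝ
  /-- filter inductance -/
  lf : ℝ
  /-- proportional gain of the voltage loop -/
  kpv : ℝ
  /-- resonant gain of the voltage loop -/
  krv : ℝ
  /-- proportional gain of the current loop -/
  kpc : ℝ
  /-- resonant gain of the current loop -/
  krc : ℝ

/-- The state `(x₁, x₂, x₃, x₄) = (v̂, i, (v, ζᵥ), (i_f, ζ_c))`, of real dimension twelve. -/
abbrev ConverterState : Type := ℂ × ℂ × (ℂ × ℂ) × (ℂ × ℂ)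

namespace ConverterState

/-- Reference voltage `v̂ = x₁`. -/
abbrev vHat (x : ConverterState) : ℂ := x.1
/-- Output (grid) current `i = x₂`. -/
abbrev iOut (x : ConverterState) : ℂ := x.2.1
/-- Capacitor voltage `v`, first part of `x₃`. -/
abbrev vCap (x : ConverterState) : ℂ := x.2.2.1.1
/-- Resonant integrator state `ζᵥ` of the voltage loop, second part of `x₃`. -/
abbrev ζv (x : ConverterState) : ℂ := x.2.2.1.2
/-- Inductor current `i_f`, first part of `x₄`. -/
abbrev iInd (x : ConverterState) : ℂ := x.2.2.2.1
/-- Resonant integrator state `ζ_c` of the current loop, second part of `x₄`. -/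
abbrev ζc (x : ConverterState) : ℂ := x.2.2.2.2

end ConverterState

namespace GridConverter

/-- The sign conventions on the parameters. -/
structure Admissible (P : GridConverter) : Prop where
  vStar_pos : 0 < P.vStar
  η_pos : 0 < P.η
  α_nonneg : 0 ≤ P.α
  rg_pos : 0 < P.rg
  lg_pos : 0 < P.lg
  cf_pos : 0 < P.cf
  lf_pos : 0 < P.lf
  kpv_pos : 0 < P.kpv
  krv_pos : 0 < P.krv
  kpc_pos : 0 < P.kpc
  krc_pos : 0 < P.krc

/-- `ω_Δ = ω₀ - ω_g`. -/
def ωΔ (P : GridConverter) : ℝ := P.ω₀ - P.ωg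

/-- Grid impedance `z = r_g + j ω_g l_g` (the matrix `Z`). -/
def z (P : GridConverter) : ℂ := (P.rg : ℂ) + I * ((P.ωg * P.lg : ℝ) : ℂ)

/-- Grid admittance `y = 1 / z` (the matrix `Y`). -/
def y (P : GridConverter) : ℂ := (P.z)⁻¹

/-- Filter admittance `g_f + j ω_g c_f` (the matrix `Y_f`). -/
def yf (P : GridConverter) : ℂ := (P.gf : ℂ) + I * ((P.ωg * P.cf : ℝ) : ℂ)

/-- The rotation `e^{jφ}` (the matrix `R_φ`). -/
def rot (P : GridConverter) : ℂ := exp (I * (P.φ : ℂ))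

/-- The rotated normalized power setpoint `e^{jφ} (p⋆ - j q⋆) / v⋆²` (the matrix `S_φ⋆`). -/
def sStar (P : GridConverter) : ℂ :=
  P.rot * (((P.pStar : ℂ) - I * (P.qStar : ℂ)) / ((P.vStar ^ 2 : ℝ) : ℂ))

/-- The amplitude regulation term `Φ(w) = (v⋆² - ‖w‖²) / v⋆²`. -/
def ampReg (P : GridConverter) (w : ℂ) : ℝ := (P.vStar ^ 2 - ‖w‖ ^ 2) / P.vStar ^ 2

/-- The inductor current reference `i_f⋆` generated by the voltage loop. -/
def iRef (P : GridConverter) (x : ConverterState) : ℂ :=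
  -(P.kpv : ℂ) * (x.vCap - x.vHat) - (P.krv : ℂ) * x.ζv + P.yf * x.vCap + x.iOut

/-- Right-hand side of the dVOC reference model. -/
def f₁ (P : GridConverter) (x : ConverterState) : ℂ :=
  I * (P.ωΔ : ℂ) * x.vHat + (P.η : ℂ) * P.sStar * x.vHat - (P.η : ℂ) * P.rot * x.iOut
    + ((P.η * P.α * P.ampReg x.vHat : ℝ) : ℂ) * x.vHat

/-- Right-hand side of the network dynamics. -/
def f₂ (P : GridConverter) (x : ConverterState) : ℂ :=
  (P.lg : ℂ)⁻¹ * (-P.z * x.iOut + x.vCap - (P.vg : ℂ))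

/-- Right-hand side of the filter capacitor and voltage loop dynamics. -/
def f₃ (P : GridConverter) (x : ConverterState) : ℂ × ℂ :=
  ((P.cf : ℂ)⁻¹ * (-P.yf * x.vCap - x.iOut + x.iInd),
    I * (P.ωΔ : ℂ) * x.ζv + x.vCap - x.vHat)

/-- Right-hand side of the filter inductor and current loop dynamics, the internal voltage
`-k_p^c (i_f - i_f⋆) - k_r^c ζ_c + Z_f i_f + v` being inserted in `l_f i_f' + Z_f i_f + v = e`. -/
def f₄ (P : GridConverter) (x : ConverterState) : ℂ × ℂ :=
  ((P.lf : ℂ)⁻¹ * (-(P.kpc : ℂ) * (x.iInd - P.iRef x) - (P.krc : ℂ) * x.ζc),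
    I * (P.ωΔ : ℂ) * x.ζc + x.iInd - P.iRef x)

/-- The vector field of the twelfth-order system. -/
def field (P : GridConverter) (x : ConverterState) : ConverterState :=
  (P.f₁ x, P.f₂ x, P.f₃ x, P.f₄ x)

/-! ### The constants in the stability conditions

`vs` is the steady-state voltage, `c₁` and `ε` are the tunable quantities. -/

/-- `c_ε = ‖S_φ⋆ - Y_φ + α I‖ + α ε ‖vs‖² / v⋆²`. -/
def cε (P : GridConverter) (vs : ℂ) (ε : ℝ) : ℝ :=
  ‖P.sStar - P.rot * P.y + (P.α : ℂ)‖ + P.α * ε * (‖vs‖ ^ 2 / P.vStar ^ 2)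

def cv (P : GridConverter) : ℝ := P.cf / P.kpv + P.cf / P.krv

def α₂ (_P : GridConverter) : ℝ := 1
def α₃ (P : GridConverter) : ℝ := 1 - P.cf / P.krv

def β₁₂ (_P : GridConverter) : ℝ := 1
def β₂₃ (P : GridConverter) : ℝ := 1 / P.rg
def β₃₄ (P : GridConverter) : ℝ := 1 / P.kpv + 1 / P.krv

def β₂₁ (P : GridConverter) (vs : ℂ) (ε : ℝ) : ℝ := P.cε vs ε * P.η * (P.lg / P.rg) * ‖P.y‖
def γ₂ (P : GridConverter) : ℝ := P.η * (P.lg / P.rg) * ‖P.y‖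

def β₃₁ (P : GridConverter) (vs : ℂ) (ε : ℝ) : ℝ := P.cε vs ε * P.cv * P.η
def β₃₂ (P : GridConverter) : ℝ := P.cv * P.η
def γ₃ (_P : GridConverter) : ℝ := 0

/-- `β₄₁ / c_c`, where `c_c = l_f / k_p^c + l_f / k_r^c`; similarly for the next three. -/
def β₄₁t (P : GridConverter) (vs : ℂ) (ε : ℝ) : ℝ := P.cε vs ε * P.η * P.kpv
def β₄₂t (P : GridConverter) : ℝ := P.η * P.kpv + ‖P.z‖ / P.lg
def β₄₃t (P : GridConverter) : ℝ :=
  1 / P.lg + (‖P.yf - (P.kpv : ℂ)‖ * (P.kpv + P.krv) / P.cf + P.krv)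
def γ₄t (P : GridConverter) : ℝ := ‖P.yf - (P.kpv : ℂ)‖ / P.cf

/-- `D₂`, with `β₂ = [β₂₁]`. -/
def D₂ (P : GridConverter) (vs : ℂ) (c₁ ε : ℝ) : ℝ :=
  (P.α₂ - P.γ₂ + P.β₂₁ vs ε / P.β₁₂ * c₁) ^ 2
    + 4 * (P.β₂₁ vs ε ^ 2 - (P.α₂ - P.γ₂) * (P.β₂₁ vs ε / P.β₁₂) * c₁)

/-- The stability margin `c₂`. -/
def c₂ (P : GridConverter) (vs : ℂ) (c₁ ε : ℝ) : ℝ :=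
  1 / 2 * (P.α₂ - P.γ₂ + P.β₂₁ vs ε / P.β₁₂ * c₁ - √(P.D₂ vs c₁ ε))

/-- `D₃`, with `β₃ = [β₃₁ / 2, β₃₂]`. -/
def D₃ (P : GridConverter) (vs : ℂ) (c₁ ε : ℝ) : ℝ :=
  (P.α₃ - P.γ₃ + P.β₃₂ / P.β₂₃ * P.c₂ vs c₁ ε) ^ 2
    + 4 * (((1 / 2 * P.β₃₁ vs ε) ^ 2 + P.β₃₂ ^ 2)
      - (P.α₃ - P.γ₃) * (P.β₃₂ / P.β₂₃) * P.c₂ vs c₁ ε)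

/-- The stability margin `c₃`. -/
def c₃ (P : GridConverter) (vs : ℂ) (c₁ ε : ℝ) : ℝ :=
  1 / 2 * (P.α₃ - P.γ₃ + P.β₃₂ / P.β₂₃ * P.c₂ vs c₁ ε - √(P.D₃ vs c₁ ε))

/-- The four quantitative stability conditions at the steady-state voltage `vs`, for a margin
`c₁ > 0` and a parameter `ε > 3`. -/
structure StabilityConditions (P : GridConverter) (vs : ℂ) (c₁ ε : ℝ) : Prop where
  c₁_pos : 0 < c₁
  three_lt_ε : 3 < ε
  condA : (P.sStar).re + P.α + c₁
    < 1 / 2 * (P.α * ‖vs‖ ^ 2 / P.vStar ^ 2) + (P.rot * P.y).re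
  condB : 0 < P.η ∧ P.η < c₁ / (P.lg / P.rg * ‖P.y‖ * (c₁ + P.cε vs ε))
  condC : 0 < (1 + P.krv / P.kpv) / (P.krv / P.cf - 1) ∧
    (1 + P.krv / P.kpv) / (P.krv / P.cf - 1)
      < 4 * P.c₂ vs c₁ ε / (1 / P.rg * P.η * (P.cε vs ε ^ 2 + 4))
  condD : 0 < (1 + P.krc / P.kpc) / (P.krc / P.lf - 1) ∧
    (1 + P.krc / P.kpc) / (P.krc / P.lf - 1)
      < 4 * P.c₃ vs c₁ ε / (P.β₃₄ / P.β₄₃t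
          * (P.β₄₁t vs ε ^ 2 + P.β₄₂t ^ 2 + 4 * P.β₄₃t ^ 2)
        + P.c₃ vs c₁ ε * P.γ₄t)

end GridConverter

end

open Complex Filter Topology Set

/-! ### Global asymptotic stability from a strict Lyapunov function -/

/-! Measure every layer from its quasi-steady state: `v̂` from `v_s`, `i` from `Y(v̂ - v_g)`, `v`
from `v̂`, `i_f` from `i_f⋆`, with both integrators measured from zero (`GridConverter.errors`).
Each layer then dissipates a storage of its own. Its decay is disturbed by the error of the next
faster layer and, beyond the first layer, by the motion of its own quasi-steady state, which is
bounded by the error magnitudes. A weighted sum of the four storages is a strict Lyapunov function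
once the resulting quadratic form in the magnitudes `ψ₁, …, ψ₄` is definite. Adding one layer at a
time reduces this to 2×2 forms: `c₂` and `c₃` are their smallest eigenvalues, (b) and (c) make these
positive, and (d) closes the last step (`StabilityConditions.exists_rate`).

Only the first layer is nonlinear. Along `δ = v̂ - v_s` its cubic term is a gradient and acts as
multiplication by a complex number in a sector (`exists_cubicDiff_eq`). A suitably weighted quartic
storage therefore has a gradient `G` and a field `F` with `‖G‖ ≤ ψ₁` and `‖F‖ ≤ c_ε ψ₁`, where `ψ₁²
= ⟨G, F⟩ / c` and `c > c₁` by (a) (`PlanarModel.dissipation`). These bounds hold for every `δ`; of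
`ε` they use only `ε > 3`.

The Lyapunov function is thus global and bounded below by a multiple of the squared distance to the
equilibrium. So the region of attraction is the whole space, and the inclusion of the set `‖x₁ -
v_s‖ < r` is immediate. -/

/-- A bounded, globally Lipschitz vector field has forward solutions from every initial state. -/
theorem exists_isForwardSolution_of_lipschitz {E : Type*} [NormedAddCommGroup E]
    [NormedSpace ℝ E] [CompleteSpace E] {g : E → E} {K L : NNReal} (hK : LipschitzWith K g)
    (hL : ∀ x, ‖g x‖ ≤ L) (x₀ : E) : ∃ x : ℝ → E, IsForwardSolution g x ∧ x 0 = x₀ := by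
  have hex : ∀ n : ℕ, ∃ α : ℝ → E, α 0 = x₀ ∧
      ∀ t ∈ Icc (0 : ℝ) n, HasDerivWithinAt α (g (α t)) (Icc (0 : ℝ) n) t := by
    intro n
    -- A field bounded by `L` moves a point at most `L * n` in time `n`, so with this ball radius
    -- Picard–Lindelöf needs no smallness of the interval.
    have hpl : IsPicardLindelof (fun _ : ℝ => g) (⟨0, left_mem_Icc.2 (Nat.cast_nonneg n)⟩ :
        Icc (0 : ℝ) n) x₀ (L * n) 0 L K :=
      { lipschitzOnWith := fun _ _ => hK.lipschitzOnWith
        continuousOn := fun _ _ => continuousOn_const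
        norm_le := fun _ _ x _ => hL x
        mul_max_le := by simp }
    exact hpl.exists_eq_forall_mem_Icc_hasDerivWithinAt₀
  choose α hα0 hα using hex
  have hright : ∀ (n : ℕ) (t : ℝ), t ∈ Ico (0 : ℝ) n →
      HasDerivWithinAt (α n) (g (α n t)) (Ici t) t := fun n t ht =>
    (hα n t (Ico_subset_Icc_self ht)).mono_of_mem_nhdsWithin
      (mem_of_superset (Icc_mem_nhdsGE ht.2) (Icc_subset_Icc_left ht.1))
  have hagree : ∀ m n : ℕ, m ≤ n → EqOn (α m) (α n) (Icc (0 : ℝ) m) := by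
    intro m n hmn
    have hmn' : (m : ℝ) ≤ n := by exact_mod_cast hmn
    refine ODE_solution_unique (v := fun _ => g) (fun _ => hK)
      (fun t ht => (hα m t ht).continuousWithinAt) (hright m)
      (fun t ht => ((hα n t (Icc_subset_Icc_right hmn' ht)).mono
        (Icc_subset_Icc_right hmn')).continuousWithinAt)
      (fun t ht => hright n t ⟨ht.1, ht.2.trans_le hmn'⟩) (by rw [hα0, hα0])
  have hsol : ∀ (n : ℕ) (t : ℝ), t ∈ Icc (0 : ℝ) n → α (⌈t⌉₊) t = α n t := by
    intro n t ht
    exact hagree _ _ (Nat.ceil_le.2 ht.2) ⟨ht.1, Nat.le_ceil t⟩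
  -- The index jumps at integers, so differentiability at `t` is read off a fixed `α n` with `n >
  -- t`, with which the glued curve agrees near `t`.
  refine ⟨fun t => α (⌈t⌉₊) t, fun t ht => ?_, by simp [hα0]⟩
  change HasDerivWithinAt _ (g (α ⌈t⌉₊ t)) _ _
  obtain ⟨n, hn⟩ := exists_nat_gt t
  have hd := hα n t ⟨ht, hn.le⟩
  have hd' : HasDerivWithinAt (α n) (g (α n t)) (Ici 0) t :=
    hd.mono_of_mem_nhdsWithin (by
      rw [← Ici_inter_Iic, mem_nhdsWithin_iff_eventually]
      filter_upwards [Iio_mem_nhds hn] with s hs hs0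
      exact ⟨hs0, mem_Iic.2 (le_of_lt hs)⟩)
  rw [show g (α ⌈t⌉₊ t) = g (α n t) by rw [hsol n t ⟨ht, hn.le⟩]]
  refine hd'.congr_of_eventuallyEq_of_mem ?_ ht
  filter_upwards [self_mem_nhdsWithin, nhdsWithin_le_nhds (Iio_mem_nhds hn)] with s hs0 hs
  exact hsol n s ⟨hs0, le_of_lt hs⟩

/-- A quadratically bounded strict Lyapunov function for `f` at `xe`. The map `DV` is the
directional derivative of `V`, described by the chain rule along curves. -/
structure IsStrictLyapunov {E : Type*} [NormedAddCommGroup E] [NormedSpace ℝ E]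
    (f : E → E) (xe : E) (V : E → ℝ) (DV : E → E → ℝ) (k k' : ℝ) : Prop where
  k_pos : 0 < k
  k'_pos : 0 < k'
  continuous : Continuous V
  apply_self : V xe = 0
  lower : ∀ x, k * ‖x - xe‖ ^ 2 ≤ V x
  chain : ∀ (γ : ℝ → E) (w : E) (s : Set ℝ) (t : ℝ), HasDerivWithinAt γ w s t →
    HasDerivWithinAt (fun τ => V (γ τ)) (DV (γ t) w) s t
  smul : ∀ (x w : E) (c : ℝ), DV x (c • w) = c * DV x w
  decrease : ∀ x, DV x (f x) ≤ -k' * ‖x - xe‖ ^ 2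

namespace IsStrictLyapunov

variable {E : Type*} [NormedAddCommGroup E] [NormedSpace ℝ E] {f : E → E} {xe : E}
  {V : E → ℝ} {DV : E → E → ℝ} {k k' : ℝ}

/-- `V` decreases along solutions of the field rescaled by a nonnegative function. -/
theorem antitoneOn (h : IsStrictLyapunov f xe V DV k k') {χ : E → ℝ} (hχ : ∀ x, 0 ≤ χ x)
    {x : ℝ → E} (hx : IsForwardSolution (fun y => χ y • f y) x) :
    AntitoneOn (fun t => V (x t)) (Ici 0) := by
  have hd : ∀ t ∈ Ici (0 : ℝ), HasDerivWithinAt (fun τ => V (x τ))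
      (DV (x t) (χ (x t) • f (x t))) (Ici 0) t := fun t ht => h.chain _ _ _ _ (hx t ht)
  refine antitoneOn_of_hasDerivWithinAt_nonpos (f' := fun t => DV (x t) (χ (x t) • f (x t)))
    (convex_Ici 0) (fun t ht => (hd t ht).continuousWithinAt)
    (fun t ht => (hd t (interior_subset ht)).mono interior_subset) (fun t _ => ?_)
  rw [h.smul]
  refine mul_nonpos_of_nonneg_of_nonpos (hχ _) ((h.decrease _).trans ?_)
  have := h.k'_pos
  nlinarith [sq_nonneg ‖x t - xe‖]

theorem value_le (h : IsStrictLyapunov f xe V DV k k') {x : ℝ → E}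
    (hx : IsForwardSolution f x) {t : ℝ} (ht : 0 ≤ t) : V (x t) ≤ V (x 0) := by
  have hx' : IsForwardSolution (fun y => (fun _ => (1 : ℝ)) y • f y) x := by simpa using hx
  exact h.antitoneOn (fun _ => zero_le_one) hx' self_mem_Ici ht ht

/-- Cut the field off by a bump function equal to one around the sublevel set of `V x₀`. The cut-off
field is a nonnegative rescaling of `f`, so `V` still decreases, the solution stays where the bump
is one, and the cutoff is never felt. -/
theorem exists_solution [FiniteDimensional ℝ E] (h : IsStrictLyapunov f xe V DV k k')
    (hf : ContDiff ℝ 1 f) (x₀ : E) : ∃ x : ℝ → E, IsForwardSolution f x ∧ x 0 = x₀ := by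
  have hk := h.k_pos
  have hV0 : 0 ≤ V x₀ := le_trans (by positivity) (h.lower x₀)
  set ρ : ℝ := √(V x₀ / k) + 1 with hρ
  have hρ0 : 0 < ρ := by positivity
  let χ : ContDiffBump xe := ⟨ρ, ρ + 1, hρ0, by linarith⟩
  have hg : ContDiff ℝ 1 (fun y => χ y • f y) := χ.contDiff.smul hf
  have hgc : HasCompactSupport (fun y => χ y • f y) := χ.hasCompactSupport.smul_right
  obtain ⟨K, hK⟩ := hg.lipschitzWith_of_hasCompactSupport hgc one_ne_zero
  obtain ⟨L, hL⟩ := hgc.exists_bound_of_continuous hg.continuous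
  obtain ⟨x, hx, hx0⟩ := exists_isForwardSolution_of_lipschitz (L := L.toNNReal) hK
    (fun y => (hL y).trans (Real.le_coe_toNNReal L)) x₀
  refine ⟨x, fun t ht => ?_, hx0⟩
  have hVt : V (x t) ≤ V x₀ := by
    have := h.antitoneOn (fun y => χ.nonneg) hx self_mem_Ici ht ht
    simpa [hx0] using this
  have hball : x t ∈ Metric.closedBall xe ρ := by
    rw [mem_closedBall_iff_norm]
    have h1 : ‖x t - xe‖ ^ 2 ≤ V x₀ / k := by
      rw [le_div_iff₀ hk]
      linarith [h.lower (x t)]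
    linarith [Real.le_sqrt_of_sq_le h1]
  have h2 := hx t ht
  simpa only [χ.one_of_mem_closedBall (x := x t) hball, one_smul] using h2

/-- If `V` stayed above some `e > 0`, continuity would keep the solution at distance at least `r`
from `xe`, and `V` would fall at rate at least `k' r²` until negative. Hence `V` becomes arbitrarily
small and, being monotone, stays so. -/
theorem tendsto (h : IsStrictLyapunov f xe V DV k k') {x : ℝ → E}
    (hx : IsForwardSolution f x) : Tendsto x atTop (𝓝 xe) := by
  have hk := h.k_pos
  have hk' := h.k'_pos
  have hx' : IsForwardSolution (fun y => (fun _ => (1 : ℝ)) y • f y) x := by simpa using hx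
  have hanti := h.antitoneOn (fun _ => zero_le_one) hx'
  have hd : ∀ t ∈ Ici (0 : ℝ), HasDerivWithinAt (fun τ => V (x τ)) (DV (x t) (f (x t))) (Ici 0) t :=
    fun t ht => h.chain _ _ _ _ (hx t ht)
  have hnn : ∀ y, 0 ≤ V y := fun y => le_trans (by positivity) (h.lower y)
  have hsmall : ∀ e > 0, ∃ T ≥ (0 : ℝ), V (x T) < e := by
    intro e he
    by_contra! hcon
    obtain ⟨r, hr, hball⟩ := Metric.continuousAt_iff.1 (h.continuous.continuousAt (x := xe)) e he
    have hfar : ∀ t ≥ (0 : ℝ), r ≤ ‖x t - xe‖ := by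
      intro t ht
      by_contra! hlt
      have h1 := hball (by rwa [dist_eq_norm] : dist (x t) xe < r)
      rw [h.apply_self, Real.dist_eq, sub_zero] at h1
      linarith [hcon t ht, le_abs_self (V (x t))]
    have hle : AntitoneOn (fun t => V (x t) + k' * r ^ 2 * t) (Ici 0) := by
      have hd2 : ∀ t ∈ Ici (0 : ℝ), HasDerivWithinAt (fun t => V (x t) + k' * r ^ 2 * t)
          (DV (x t) (f (x t)) + k' * r ^ 2) (Ici 0) t := fun t ht => by
        have h6 := (hd t ht).add ((hasDerivWithinAt_id t (Ici 0)).const_mul (k' * r ^ 2))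
        rw [mul_one] at h6
        exact h6
      refine antitoneOn_of_hasDerivWithinAt_nonpos (f' := fun t => DV (x t) (f (x t)) + k' * r ^ 2)
        (convex_Ici 0)
        (fun t ht => (hd2 t ht).continuousWithinAt)
        (fun t ht => (hd2 t (interior_subset ht)).mono interior_subset) (fun t ht => ?_)
      have h1 := h.decrease (x t)
      have h2 := hfar t (interior_subset ht)
      have h3 : r ^ 2 ≤ ‖x t - xe‖ ^ 2 := by gcongr
      nlinarith
    have hT : 0 ≤ (V (x 0) + 1) / (k' * r ^ 2) := by have := hnn (x 0); positivity
    have h4 := hle self_mem_Ici hT hT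
    have h5 : k' * r ^ 2 * ((V (x 0) + 1) / (k' * r ^ 2)) = V (x 0) + 1 := by field_simp
    simp only [mul_zero, add_zero] at h4
    rw [h5] at h4
    linarith [hnn (x ((V (x 0) + 1) / (k' * r ^ 2)))]
  rw [Metric.tendsto_atTop]
  intro e he
  obtain ⟨T, hT, hVT⟩ := hsmall (k * e ^ 2) (by positivity)
  refine ⟨T, fun t ht => ?_⟩
  have h1 : V (x t) ≤ V (x T) := hanti hT (hT.trans ht) ht
  have h2 := h.lower (x t)
  rw [dist_eq_norm]
  refine lt_of_pow_lt_pow_left₀ 2 he.le ?_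
  exact lt_of_mul_lt_mul_left (by linarith) hk.le

theorem regionOfAttraction_eq_univ [FiniteDimensional ℝ E] (h : IsStrictLyapunov f xe V DV k k')
    (hf : ContDiff ℝ 1 f) : regionOfAttraction f xe = univ :=
  eq_univ_of_forall fun x₀ => ⟨h.exists_solution hf x₀, fun _ hx _ => h.tendsto hx⟩

theorem lyapunovStable [FiniteDimensional ℝ E] (h : IsStrictLyapunov f xe V DV k k')
    (hf : ContDiff ℝ 1 f) : LyapunovStable f xe := by
  have hk := h.k_pos
  intro ρ hρ
  obtain ⟨r, hr, hball⟩ := Metric.continuousAt_iff.1 (h.continuous.continuousAt (x := xe))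
    (k * ρ ^ 2) (by positivity)
  refine ⟨r, hr, fun x₀ hx₀ => ⟨h.exists_solution hf x₀, fun x hx hx0 t ht => ?_⟩⟩
  have h1 := hball (by rwa [dist_eq_norm] : dist x₀ xe < r)
  rw [h.apply_self, Real.dist_eq, sub_zero] at h1
  have h2 := h.value_le hx ht
  rw [hx0] at h2
  refine lt_of_pow_lt_pow_left₀ 2 hρ.le ?_
  exact lt_of_mul_lt_mul_left (by linarith [h.lower (x t), le_abs_self (V x₀)]) hk.le

end IsStrictLyapunov

/-! ### A quartic Lyapunov function for the planar reference model

In the coordinate `δ = x - v` the reference model is `δ' = -(d δ + a (‖x‖² x - ‖v‖² v))`. -/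

theorem abs_mul_le_of_sq_le {A D R Q : ℝ} (hA : 0 ≤ A) (hQ : Q ^ 2 ≤ 2 * A * R) (hR : 0 ≤ R) :
    |Q * D| ≤ D ^ 2 * R + A / 2 := by
  refine abs_le_of_sq_le_sq ?_ (by positivity)
  nlinarith [sq_nonneg (D ^ 2 * R - A / 2), mul_le_mul_of_nonneg_left hQ (sq_nonneg D)]

/-- Up to scaling, `E + R + jQ` is the multiplier of the gradient and `1 + R + j(D + Q)` that of the
field. The rotation contributes the indefinite term `Q D`; weighting by `E = 1 + D²` produces a
matching `D² R`, and the sector bound leaves a deficit of at most `A / 2`. The prefactor `E + A`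
pays for it, thanks to `A ≤ 4 R`. -/
theorem gradient_norm_sq_le {A D R Q : ℝ} (hA : 0 ≤ A) (hQ : Q ^ 2 ≤ 2 * A * R)
    (hR : A ≤ 4 * R) :
    (1 + D ^ 2 + R) ^ 2 + Q ^ 2
      ≤ (1 + D ^ 2 + A) * ((1 + D ^ 2 + R) * (1 + R) + Q * (D + Q)) := by
  have hR0 : 0 ≤ R := by linarith
  have hQD := (abs_le.1 (abs_mul_le_of_sq_le (D := D) hA hQ hR0)).1
  set E := 1 + D ^ 2 with hE
  have hE1 : 1 ≤ E := by rw [hE]; nlinarith [sq_nonneg D]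
  have hX : E * (E + A) / 2 ≤ (E + R) ^ 2 + Q ^ 2 := by nlinarith [sq_nonneg Q, sq_nonneg R]
  have hY : (E + R) ^ 2 + Q ^ 2 - E * A / 2 ≤ E * ((E + R) * (1 + R) + Q * (D + Q)) := by
    have h1 : E * ((E + R) * (1 + R) + Q * (D + Q))
        = (E + R) ^ 2 + Q ^ 2 + D ^ 2 * R ^ 2 + D ^ 2 * Q ^ 2 + E * (D ^ 2 * R + Q * D) := by
      rw [hE]; ring
    rw [h1]
    nlinarith [mul_nonneg (sq_nonneg D) (sq_nonneg R), mul_nonneg (sq_nonneg D) (sq_nonneg Q)]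
  have h2 := mul_le_mul_of_nonneg_left hY (by linarith : 0 ≤ E + A)
  have h3 := mul_le_mul_of_nonneg_left hX hA
  have h4 : E * ((E + R) ^ 2 + Q ^ 2)
      ≤ E * ((E + A) * ((E + R) * (1 + R) + Q * (D + Q))) := by nlinarith
  exact le_of_mul_le_mul_left h4 (by linarith)

/-- The squared field multiplier exceeds the dissipation `Y` only by `Q D - D² R ≤ A / 2`; since `Y
≥ 3 E / 4`, this excess is absorbed by the terms of `K²` in `A`. -/
theorem field_norm_sq_le {A D R Q K : ℝ} (hA : 0 ≤ A) (hQ : Q ^ 2 ≤ 2 * A * R)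
    (hR : A ≤ 4 * R) (hK : √(1 + D ^ 2) + 5 / 2 * A ≤ K) :
    (1 + D ^ 2 + A) * ((1 + R) ^ 2 + (D + Q) ^ 2)
      ≤ K ^ 2 * ((1 + D ^ 2 + R) * (1 + R) + Q * (D + Q)) := by
  have hR0 : 0 ≤ R := by linarith
  have hQD := (abs_le.1 (abs_mul_le_of_sq_le (D := D) hA hQ hR0)).2
  set E := 1 + D ^ 2 with hE
  have hE1 : 1 ≤ E := by rw [hE]; nlinarith [sq_nonneg D]
  have hs1 : 1 ≤ √E := Real.one_le_sqrt.2 hE1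
  have hs2 : √E ^ 2 = E := Real.sq_sqrt (by linarith)
  have hK2 : E + 5 * A + 25 / 4 * A ^ 2 ≤ K ^ 2 := by
    have h1 : (√E + 5 / 2 * A) ^ 2 ≤ K ^ 2 := by gcongr
    nlinarith
  set Y := (E + R) * (1 + R) + Q * (D + Q) with hY
  have hYE : 3 / 4 * E ≤ Y := by
    rw [hY, hE]
    nlinarith [sq_nonneg (Q + D / 2), mul_nonneg (sq_nonneg D) hR0]
  have hZ : (1 + R) ^ 2 + (D + Q) ^ 2 ≤ Y + A / 2 := by
    have : (1 + R) ^ 2 + (D + Q) ^ 2 = Y - D ^ 2 * R + Q * D := by rw [hY, hE]; ring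
    linarith
  calc (E + A) * ((1 + R) ^ 2 + (D + Q) ^ 2) ≤ (E + A) * (Y + A / 2) := by gcongr
    _ ≤ (E + 5 * A + 25 / 4 * A ^ 2) * Y := by
      have h1 : 0 ≤ A * (Y - 3 / 4 * E) := mul_nonneg hA (by linarith)
      have h2 : 0 ≤ A ^ 2 * (Y - 3 / 4 * E) := mul_nonneg (by positivity) (by linarith)
      have h3 : 0 ≤ A ^ 2 * (E - 1) := mul_nonneg (by positivity) (by linarith)
      nlinarith [mul_nonneg hA (by linarith : 0 ≤ E)]
    _ ≤ K ^ 2 * Y := by gcongr; linarith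

/-- The cubic term `‖v + δ‖² (v + δ) - ‖v‖² v`. -/
noncomputable def cubicDiff (v δ : ℂ) : ℂ :=
  ((‖v + δ‖ ^ 2 : ℝ) : ℂ) * (v + δ) - ((‖v‖ ^ 2 : ℝ) : ℂ) * v

/-- With `p = ‖v + δ‖`, `q = ‖v‖`, use `‖δ‖ ≤ p + q`. If `q² > 2p²`, the claim reduces to `2(p - q)²
- q² + 2p² = (q - 2p)² ≥ 0`. -/
theorem norm_sq_mul_le (v δ : ℂ) :
    ‖v‖ ^ 2 * ‖δ‖ ^ 2 ≤ 2 * ‖v + δ‖ ^ 2 * ‖δ‖ ^ 2 + 2 * (‖v + δ‖ ^ 2 - ‖v‖ ^ 2) ^ 2 := by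
  have hδ : ‖δ‖ ≤ ‖v + δ‖ + ‖v‖ := by simpa using norm_sub_le (v + δ) v
  set p := ‖v + δ‖
  set q := ‖v‖
  have hp : 0 ≤ p := norm_nonneg _
  have hq : 0 ≤ q := norm_nonneg _
  have hδ2 : ‖δ‖ ^ 2 ≤ (p + q) ^ 2 := by gcongr
  rcases le_total (q ^ 2) (2 * p ^ 2) with h | h
  · nlinarith [mul_le_mul_of_nonneg_right h (sq_nonneg ‖δ‖), sq_nonneg (p ^ 2 - q ^ 2)]
  · nlinarith [mul_le_mul_of_nonneg_left hδ2 (sub_nonneg.2 h),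
      mul_nonneg (sq_nonneg (q - 2 * p)) (sq_nonneg (p + q))]

/-- In the direction of `δ`, the cubic term acts as a multiplication in a sector. -/
theorem exists_cubicDiff_eq (v δ : ℂ) : ∃ R Q : ℝ,
    cubicDiff v δ - ((‖v‖ ^ 2 / 2 : ℝ) : ℂ) * δ = (⟨R, Q⟩ : ℂ) * δ ∧
    Q ^ 2 ≤ 2 * ‖v‖ ^ 2 * R ∧ ‖v‖ ^ 2 ≤ 4 * R := by
  rcases eq_or_ne δ 0 with rfl | hδ
  -- At `δ = 0` the multiplier is arbitrary; this one meets both bounds.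
  · exact ⟨‖v‖ ^ 2, 0, by simp [cubicDiff], by nlinarith [sq_nonneg (‖v‖ ^ 2)],
      by nlinarith [sq_nonneg ‖v‖]⟩
  have hs : 0 < ‖δ‖ ^ 2 := by positivity
  set w := ‖v + δ‖ ^ 2 with hw
  set u := ‖v‖ ^ 2 with hu
  set s := ‖δ‖ ^ 2 with hs'
  set C := δ.re * v.im - δ.im * v.re with hC
  have hwe : w = (v.re + δ.re) ^ 2 + (v.im + δ.im) ^ 2 := by
    rw [hw, ← Complex.normSq_eq_norm_sq, Complex.normSq_apply]; simp; ring
  have hue : u = v.re ^ 2 + v.im ^ 2 := by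
    rw [hu, ← Complex.normSq_eq_norm_sq, Complex.normSq_apply]; ring
  have hse : s = δ.re ^ 2 + δ.im ^ 2 := by
    rw [hs', ← Complex.normSq_eq_norm_sq, Complex.normSq_apply]; ring
  have hkey := norm_sq_mul_le v δ
  rw [← hw, ← hu, ← hs'] at hkey
  -- The cubic term is `w δ + (w - u) v`. Divide by `δ`: `v / δ` has imaginary part `C / s` and,
  -- since `w = u + 2⟨v, δ⟩ + s`, real part `(w - u - s) / (2 s)`.
  refine ⟨w / 2 + (w - u) ^ 2 / (2 * s), (w - u) * C / s, ?_, ?_, ?_⟩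
  · apply Complex.ext
    · simp only [cubicDiff, Complex.sub_re, Complex.mul_re, Complex.add_re, Complex.ofReal_re,
        Complex.ofReal_im]
      rw [← hw, ← hu]
      field_simp
      rw [hC, hwe, hue, hse]
      ring
    · simp only [cubicDiff, Complex.sub_im, Complex.mul_im, Complex.add_im, Complex.ofReal_re,
        Complex.ofReal_im]
      rw [← hw, ← hu]
      field_simp
      rw [hC, hwe, hue, hse]
      ring
  · have hCS : C ^ 2 ≤ s * u := by
      rw [hC, hse, hue]; nlinarith [sq_nonneg (δ.re * v.re + δ.im * v.im)]
    have hw0 : 0 ≤ w := by positivity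
    have hu0 : 0 ≤ u := by positivity
    have h1 : ((w - u) * C / s) ^ 2 ≤ u * (w - u) ^ 2 / s := by
      rw [div_pow, div_le_div_iff₀ (by positivity) hs]
      nlinarith [mul_le_mul_of_nonneg_left hCS (mul_nonneg (sq_nonneg (w - u)) hs.le)]
    have h2 : 2 * u * (w / 2 + (w - u) ^ 2 / (2 * s)) = u * w + u * (w - u) ^ 2 / s := by
      field_simp
    rw [h2]
    nlinarith [mul_nonneg hu0 hw0]
  · have h2 : 4 * (w / 2 + (w - u) ^ 2 / (2 * s)) = (2 * w * s + 2 * (w - u) ^ 2) / s := by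
      field_simp; ring
    rw [h2, le_div_iff₀ hs]
    linarith

theorem inner_mul_mul_right (z w δ : ℂ) :
    inner ℝ (z * δ) (w * δ) = (z.re * w.re + z.im * w.im) * ‖δ‖ ^ 2 := by
  rw [Complex.inner, ← Complex.normSq_eq_norm_sq, Complex.normSq_apply]
  simp
  ring

theorem norm_mul_sq (z δ : ℂ) : ‖z * δ‖ ^ 2 = (z.re ^ 2 + z.im ^ 2) * ‖δ‖ ^ 2 := by
  rw [norm_mul, mul_pow, ← Complex.normSq_eq_norm_sq z, Complex.normSq_apply]
  ring

/-- Data of the planar model: `d` the linear part, `a` the cubic gain, `v` the equilibrium. -/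
structure PlanarModel where
  d : ℂ
  a : ℝ
  v : ℂ

namespace PlanarModel

noncomputable section

variable (M : PlanarModel)

/-- The dissipation rate at the equilibrium. -/
def c : ℝ := M.d.re + M.a * ‖M.v‖ ^ 2 / 2

/-- Weight of the quadratic part of the storage against the quartic part; it compensates the
rotation `Im d`, which is not a gradient. -/
def E : ℝ := 1 + (M.d.im / M.c) ^ 2

/-- Normalization for which the gradient satisfies `c ‖G‖² ≤ ⟨G, F⟩` with exactly the rate `c`. -/
def m : ℝ := M.E / (M.E + M.a * ‖M.v‖ ^ 2 / M.c)

def F (δ : ℂ) : ℂ := M.d * δ + (M.a : ℂ) * cubicDiff M.v δ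

def storage (δ : ℂ) : ℝ :=
  M.m * (‖δ‖ ^ 2 / 2 + M.a / (M.E * M.c) *
    (‖M.v‖ ^ 2 * ‖δ‖ ^ 2 / 4 + (‖M.v + δ‖ ^ 2 - ‖M.v‖ ^ 2) ^ 2 / 4))

def grad (δ : ℂ) : ℂ :=
  (M.m : ℂ) * (δ + ((M.a / (M.E * M.c) : ℝ) : ℂ) *
    (cubicDiff M.v δ - ((‖M.v‖ ^ 2 / 2 : ℝ) : ℂ) * δ))

variable {M}

theorem E_pos : 0 < M.E := by unfold E; positivity

theorem m_pos (ha : 0 ≤ M.a) (hc : 0 < M.c) : 0 < M.m := by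
  have := M.E_pos
  unfold m; positivity

theorem hasDerivWithinAt_storage {γ : ℝ → ℂ} {w : ℂ} {s : Set ℝ} {t : ℝ}
    (h : HasDerivWithinAt γ w s t) :
    HasDerivWithinAt (fun τ => M.storage (γ τ)) (inner ℝ (M.grad (γ t)) w) s t := by
  have h1 := h.norm_sq
  have h2 := (h.const_add M.v).norm_sq
  have h3 := ((h1.div_const 2).add ((((h1.const_mul (‖M.v‖ ^ 2)).div_const 4).add
    (((h2.sub_const (‖M.v‖ ^ 2)).pow 2).div_const 4)).const_mul (M.a / (M.E * M.c)))).const_mul M.m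
  refine h3.congr_deriv ?_
  simp only [grad, cubicDiff, Complex.inner, Complex.conj_re, Complex.conj_im,
    Complex.sub_re, Complex.mul_re, Complex.add_re, Complex.ofReal_re,
    Complex.ofReal_im, Complex.sub_im, Complex.mul_im, Complex.add_im]
  push_cast
  ring

theorem storage_lower (ha : 0 ≤ M.a) (hc : 0 < M.c) (δ : ℂ) :
    M.m / 2 * ‖δ‖ ^ 2 ≤ M.storage δ := by
  have hm := M.m_pos ha hc
  have hE := M.E_pos
  have h : 0 ≤ M.m * (M.a / (M.E * M.c) *
    (‖M.v‖ ^ 2 * ‖δ‖ ^ 2 / 4 + (‖M.v + δ‖ ^ 2 - ‖M.v‖ ^ 2) ^ 2 / 4)) := by positivity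
  unfold storage
  linarith

theorem continuous_storage : Continuous M.storage := by
  unfold storage; fun_prop

theorem storage_zero : M.storage 0 = 0 := by simp [storage]

/-- Gradient and field are both complex multiples of `δ`. After division by `c` everything depends
on the normalized quantities `A`, `D`, `r`, `q`, and the two scalar inequalities above apply. -/
theorem dissipation (ha : 0 ≤ M.a) (hc : 0 < M.c) (δ : ℂ) {κ : ℝ}
    (hκ : ‖M.d‖ + 3 * (M.a * ‖M.v‖ ^ 2) ≤ κ) :
    M.c * ‖M.grad δ‖ ^ 2 ≤ inner ℝ (M.grad δ) (M.F δ) ∧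
    M.c * ‖M.F δ‖ ^ 2 ≤ κ ^ 2 * inner ℝ (M.grad δ) (M.F δ) ∧
    M.m ^ 2 * ‖δ‖ ^ 2 ≤ ‖M.grad δ‖ ^ 2 := by
  obtain ⟨R, Q, hRQ, hQ, hR⟩ := exists_cubicDiff_eq M.v δ
  have hm := M.m_pos ha hc
  have hE := M.E_pos
  set c := M.c with hcdef
  set A := M.a * ‖M.v‖ ^ 2 / c with hA
  set D := M.d.im / c with hD
  set r := M.a * R / c with hr
  set q := M.a * Q / c with hq
  have hA0 : 0 ≤ A := by positivity
  have hR0 : 0 ≤ R := by nlinarith [sq_nonneg ‖M.v‖]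
  have hr0 : 0 ≤ r := by positivity
  have hEe : M.E = 1 + D ^ 2 := rfl
  have hme : M.m = (1 + D ^ 2) / (1 + D ^ 2 + A) := rfl
  have hq2 : q ^ 2 ≤ 2 * A * r := by
    have : 2 * A * r = M.a ^ 2 / c ^ 2 * (2 * ‖M.v‖ ^ 2 * R) := by rw [hA, hr]; field_simp
    rw [this, show q ^ 2 = M.a ^ 2 / c ^ 2 * Q ^ 2 by rw [hq]; field_simp]
    gcongr
  have hAr : A ≤ 4 * r := by
    have : 4 * r = M.a / c * (4 * R) := by rw [hr]; field_simp
    rw [this, show A = M.a / c * ‖M.v‖ ^ 2 by rw [hA]; field_simp]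
    gcongr
  have hG : M.grad δ = (⟨M.m * (1 + r / M.E), M.m * (q / M.E)⟩ : ℂ) * δ := by
    rw [grad, hRQ, ← hcdef]
    apply Complex.ext <;> simp only [hr, hq, Complex.mul_re, Complex.add_re, Complex.ofReal_re,
      Complex.ofReal_im, Complex.mul_im, Complex.add_im] <;> field_simp <;> ring
  have hF : M.F δ = (⟨c * (1 + r), c * (D + q)⟩ : ℂ) * δ := by
    have h1 : cubicDiff M.v δ = (⟨R, Q⟩ : ℂ) * δ + ((‖M.v‖ ^ 2 / 2 : ℝ) : ℂ) * δ := by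
      rw [← hRQ]; ring
    have h2 : M.d = ⟨c - M.a * ‖M.v‖ ^ 2 / 2, c * D⟩ := by
      apply Complex.ext
      · simp [hcdef, PlanarModel.c]
      · simp only [hD]; field_simp
    have h3 : c * r = M.a * R := by rw [hr]; field_simp
    have h4 : c * q = M.a * Q := by rw [hq]; field_simp
    rw [F, h1, h2, mul_add c, mul_add c, h3, h4]
    apply Complex.ext <;> simp only [Complex.mul_re, Complex.add_re, Complex.ofReal_re,
      Complex.ofReal_im, Complex.mul_im, Complex.add_im] <;> ring
  -- Moving `‖v‖² a / 2` into the linear part turns `d` into `c + j Im d`, of modulus `c √(1 + D²)`.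
  -- This costs one half of the three available units, whence `5 / 2`.
  have hKc : √(1 + D ^ 2) + 5 / 2 * A ≤ κ / c := by
    rw [le_div_iff₀ hc]
    have h1 : (√(1 + D ^ 2) * c) = ‖(⟨c, M.d.im⟩ : ℂ)‖ := by
      rw [Complex.norm_eq_sqrt_sq_add_sq]
      have : c ^ 2 + M.d.im ^ 2 = (1 + D ^ 2) * c ^ 2 := by rw [hD]; field_simp
      simp only
      rw [this, Real.sqrt_mul (by positivity), Real.sqrt_sq hc.le]
    have h2 : (⟨c, M.d.im⟩ : ℂ) = M.d + ((M.a * ‖M.v‖ ^ 2 / 2 : ℝ) : ℂ) := by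
      apply Complex.ext <;>
        simp only [hcdef, PlanarModel.c, Complex.add_re, Complex.add_im, Complex.ofReal_re,
          Complex.ofReal_im, add_zero]
    have h3 : ‖(⟨c, M.d.im⟩ : ℂ)‖ ≤ ‖M.d‖ + M.a * ‖M.v‖ ^ 2 / 2 := by
      rw [h2]
      refine (norm_add_le _ _).trans ?_
      rw [Complex.norm_of_nonneg (by positivity)]
    have h4 : A * c = M.a * ‖M.v‖ ^ 2 := by rw [hA]; field_simp
    nlinarith
  have hC1 := gradient_norm_sq_le (D := D) hA0 hq2 hAr
  have hC2 := field_norm_sq_le (D := D) hA0 hq2 hAr hKc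
  have hI : inner ℝ (M.grad δ) (M.F δ)
      = c / (1 + D ^ 2 + A) * ((1 + D ^ 2 + r) * (1 + r) + q * (D + q)) * ‖δ‖ ^ 2 := by
    rw [hG, hF, inner_mul_mul_right, hme, hEe]
    have : 0 < 1 + D ^ 2 + A := by positivity
    field_simp
  have hEA : 0 < 1 + D ^ 2 + A := by positivity
  refine ⟨?_, ?_, ?_⟩
  · rw [hI, hG, norm_mul_sq, ← mul_assoc]
    refine mul_le_mul_of_nonneg_right ?_ (sq_nonneg _)
    rw [hme, hEe]
    have h1 : c * (((1 + D ^ 2) / (1 + D ^ 2 + A) * (1 + r / (1 + D ^ 2))) ^ 2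
        + ((1 + D ^ 2) / (1 + D ^ 2 + A) * (q / (1 + D ^ 2))) ^ 2)
        = c / (1 + D ^ 2 + A) ^ 2 * ((1 + D ^ 2 + r) ^ 2 + q ^ 2) := by field_simp
    have h2 : c / (1 + D ^ 2 + A) * ((1 + D ^ 2 + r) * (1 + r) + q * (D + q))
        = c / (1 + D ^ 2 + A) ^ 2 *
          ((1 + D ^ 2 + A) * ((1 + D ^ 2 + r) * (1 + r) + q * (D + q))) := by field_simp
    simp only
    rw [h1, h2]
    gcongr
  · rw [hI, hF, norm_mul_sq, ← mul_assoc, ← mul_assoc]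
    refine mul_le_mul_of_nonneg_right ?_ (sq_nonneg _)
    have h1 : c * ((c * (1 + r)) ^ 2 + (c * (D + q)) ^ 2)
        = c ^ 3 / (1 + D ^ 2 + A) * ((1 + D ^ 2 + A) * ((1 + r) ^ 2 + (D + q) ^ 2)) := by
      field_simp
    have h2 : κ ^ 2 * (c / (1 + D ^ 2 + A) * ((1 + D ^ 2 + r) * (1 + r) + q * (D + q)))
        = c ^ 3 / (1 + D ^ 2 + A) *
          ((κ / c) ^ 2 * ((1 + D ^ 2 + r) * (1 + r) + q * (D + q))) := by field_simp
    simp only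
    rw [h1, h2]
    gcongr
  · rw [hG, norm_mul_sq]
    refine mul_le_mul_of_nonneg_right ?_ (sq_nonneg _)
    simp only
    have h1 : 1 ≤ 1 + r / M.E := by have : 0 ≤ r / M.E := by positivity
                                    linarith
    nlinarith [sq_nonneg (M.m * (q / M.E)), mul_le_mul_of_nonneg_left h1 hm.le]

end

end PlanarModel

/-! ### Quadratic forms in two magnitudes -/

/-- The smaller eigenvalue of the symmetric matrix with diagonal `p`, `q` and squared off-diagonal
entry `B`. -/
noncomputable def minEigenvalue (p q B : ℝ) : ℝ :=
  1 / 2 * (p + q - √((p + q) ^ 2 + 4 * (B - p * q)))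

theorem minEigenvalue_le {p q B : ℝ} (hB : 0 ≤ B) : minEigenvalue p q B ≤ q := by
  have h : |p - q| ≤ √((p + q) ^ 2 + 4 * (B - p * q)) := Real.abs_le_sqrt (by nlinarith)
  unfold minEigenvalue
  linarith [le_abs_self (p - q)]

theorem minEigenvalue_pos {p q B : ℝ} (hp : 0 < p) (hq : 0 < q) (h : B < p * q) :
    0 < minEigenvalue p q B := by
  have : √((p + q) ^ 2 + 4 * (B - p * q)) < p + q :=
    (Real.sqrt_lt' (by positivity)).2 (by linarith)
  unfold minEigenvalue
  linarith

/-- With `μ` the eigenvalue, `p - μ` and `q - μ` are nonnegative with product `B`, so AM-GM bounds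
the cross term. `S` and `T` stand for `‖x‖²` and `⟨b, x⟩`, which lets the first block hold several
magnitudes. -/
theorem minEigenvalue_mul_le {p q B S T y : ℝ} (hB : 0 ≤ B) (hS : 0 ≤ S) (hT : T ^ 2 ≤ B * S) :
    minEigenvalue p q B * (S + y ^ 2) ≤ p * S - 2 * T * y + q * y ^ 2 := by
  have hΔ : (p + q) ^ 2 + 4 * (B - p * q) = (p - q) ^ 2 + 4 * B := by ring
  have hμ : minEigenvalue p q B = 1 / 2 * (p + q - √((p + q) ^ 2 + 4 * (B - p * q))) := rfl
  set s := √((p + q) ^ 2 + 4 * (B - p * q)) with hs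
  have hs2 : s ^ 2 = (p - q) ^ 2 + 4 * B := by
    rw [hs, Real.sq_sqrt (by rw [hΔ]; positivity), hΔ]
  have habs : |p - q| ≤ s := Real.abs_le_sqrt (by nlinarith)
  set μ := minEigenvalue p q B
  have hP : 0 ≤ p - μ := by rw [hμ]; linarith [neg_abs_le (p - q)]
  have hQ : 0 ≤ q - μ := by rw [hμ]; linarith [le_abs_self (p - q)]
  have hPQ : (p - μ) * (q - μ) = B := by rw [hμ]; nlinarith
  have h1 : |2 * T * y| ≤ (p - μ) * S + (q - μ) * y ^ 2 := by
    refine abs_le_of_sq_le_sq ?_ (by positivity)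
    have h2 : (2 * T * y) ^ 2 ≤ 4 * (((p - μ) * S) * ((q - μ) * y ^ 2)) := by
      have : 4 * (((p - μ) * S) * ((q - μ) * y ^ 2)) = 4 * (B * S * y ^ 2) := by rw [← hPQ]; ring
      rw [this]
      nlinarith [mul_le_mul_of_nonneg_right hT (sq_nonneg y)]
    nlinarith [sq_nonneg ((p - μ) * S - (q - μ) * y ^ 2)]
  linarith [(abs_le.1 h1).2]

theorem sq_sum_three_le (a b c x y z : ℝ) :
    (a * x + b * y + c * z) ^ 2 ≤ (a ^ 2 + b ^ 2 + c ^ 2) * (x ^ 2 + y ^ 2 + z ^ 2) := by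
  linarith [sq_nonneg (a * y - b * x), sq_nonneg (a * z - c * x), sq_nonneg (b * z - c * y)]

/-! ### Proportional-resonant loops -/

/-- Storage function of the loop `c e' = -k_p e - k_r ζ`, `ζ' = e`. -/
noncomputable def loopStorage (c kp kr : ℝ) (e ζ : ℂ) : ℝ :=
  (c / kp * ‖e‖ ^ 2 + 2 * (c / kr) * inner ℝ e ζ + (kr / kp + kp / kr) * ‖ζ‖ ^ 2) / 2

/-- Directional derivative of `loopStorage`. -/
noncomputable def loopStorageDeriv (c kp kr : ℝ) (e ζ e' ζ' : ℂ) : ℝ :=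
  c / kp * inner ℝ e e' + c / kr * (inner ℝ e ζ' + inner ℝ ζ e')
    + (kr / kp + kp / kr) * inner ℝ ζ ζ'

theorem hasDerivWithinAt_loopStorage (c kp kr : ℝ) {e ζ : ℝ → ℂ} {e' ζ' : ℂ} {s : Set ℝ} {t : ℝ}
    (he : HasDerivWithinAt e e' s t) (hζ : HasDerivWithinAt ζ ζ' s t) :
    HasDerivWithinAt (fun τ => loopStorage c kp kr (e τ) (ζ τ))
      (loopStorageDeriv c kp kr (e t) (ζ t) e' ζ') s t := by
  have h := (((he.norm_sq.const_mul (c / kp)).add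
    ((he.inner ℝ hζ).const_mul (2 * (c / kr)))).add
    (hζ.norm_sq.const_mul (kr / kp + kp / kr))).div_const 2
  refine h.congr_deriv ?_
  rw [loopStorageDeriv, real_inner_comm (ζ t) e']
  ring

theorem exists_loopStorage_lower {c kp kr : ℝ} (hc : 0 < c) (hkp : 0 < kp) (hkr : c < kr) :
    ∃ k > 0, ∀ e ζ : ℂ, k * (‖e‖ ^ 2 + ‖ζ‖ ^ 2) ≤ loopStorage c kp kr e ζ := by
  have hkr0 : 0 < kr := hc.trans hkr
  refine ⟨minEigenvalue (c / kp) (kr / kp + kp / kr) ((c / kr) ^ 2) / 2, ?_, fun e ζ => ?_⟩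
  · refine half_pos (minEigenvalue_pos (by positivity) (by positivity) ?_)
    have h1 : c / kp * (kr / kp + kp / kr) = c * kr / kp ^ 2 + c / kr := by field_simp
    have h2 : (c / kr) ^ 2 ≤ c / kr := by
      have : c / kr ≤ 1 := (div_le_one hkr0).2 hkr.le
      have h0 : 0 ≤ c / kr := by positivity
      nlinarith
    have h3 : 0 < c * kr / kp ^ 2 := by positivity
    linarith
  · have h := minEigenvalue_mul_le (p := c / kp) (q := kr / kp + kp / kr) (B := (c / kr) ^ 2)
      (S := ‖e‖ ^ 2) (T := c / kr * ‖e‖) (y := ‖ζ‖) (by positivity) (by positivity)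
      (by rw [mul_pow])
    have h2 := (abs_le.1 (abs_real_inner_le_norm e ζ)).1
    have h3 : 0 ≤ c / kr := by positivity
    unfold loopStorage
    nlinarith [mul_le_mul_of_nonneg_left h2 h3]

/-- The weight `kr / kp + kp / kr` on `‖ζ‖²` is the one that cancels every `⟨e, ζ⟩` term, leaving
`-(1 - c / kr)‖e‖² - ‖ζ‖²` and the effect of `u`. -/
theorem loopStorageDeriv_le {c kp kr : ℝ} (hc : 0 < c) (hkp : 0 < kp) (hkr : 0 < kr)
    (e ζ u : ℂ) :
    loopStorageDeriv c kp kr e ζ ((c : ℂ)⁻¹ * (-(kp : ℂ) * e - (kr : ℂ) * ζ) + u) e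
      ≤ -(1 - c / kr) * (‖e‖ ^ 2 + ‖ζ‖ ^ 2)
        + (c / kp + c / kr) * √(‖e‖ ^ 2 + ‖ζ‖ ^ 2) * ‖u‖ := by
  have hsplit : loopStorageDeriv c kp kr e ζ ((c : ℂ)⁻¹ * (-(kp : ℂ) * e - (kr : ℂ) * ζ) + u) e
      = -(1 - c / kr) * ‖e‖ ^ 2 - ‖ζ‖ ^ 2 + c / kp * inner ℝ e u + c / kr * inner ℝ ζ u := by
    rw [← Complex.normSq_eq_norm_sq, ← Complex.normSq_eq_norm_sq, Complex.normSq_apply,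
      Complex.normSq_apply, ← Complex.ofReal_inv]
    simp only [loopStorageDeriv, Complex.inner, Complex.mul_re, Complex.mul_im, Complex.add_re,
      Complex.add_im, Complex.sub_re, Complex.sub_im, Complex.neg_re, Complex.neg_im,
      Complex.ofReal_re, Complex.ofReal_im, Complex.conj_re, Complex.conj_im]
    field_simp
    ring
  have h1 : ‖e‖ ≤ √(‖e‖ ^ 2 + ‖ζ‖ ^ 2) := Real.le_sqrt_of_sq_le (by nlinarith [sq_nonneg ‖ζ‖])
  have h2 : ‖ζ‖ ≤ √(‖e‖ ^ 2 + ‖ζ‖ ^ 2) := Real.le_sqrt_of_sq_le (by nlinarith [sq_nonneg ‖e‖])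
  have h3 : inner ℝ e u ≤ √(‖e‖ ^ 2 + ‖ζ‖ ^ 2) * ‖u‖ :=
    (real_inner_le_norm e u).trans (by gcongr)
  have h4 : inner ℝ ζ u ≤ √(‖e‖ ^ 2 + ‖ζ‖ ^ 2) * ‖u‖ :=
    (real_inner_le_norm ζ u).trans (by gcongr)
  have h5 := mul_le_mul_of_nonneg_left h3 (by positivity : 0 ≤ c / kp)
  have h6 := mul_le_mul_of_nonneg_left h4 (by positivity : 0 ≤ c / kr)
  have h7 : 0 ≤ c / kr * ‖ζ‖ ^ 2 := by positivity
  rw [hsplit]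
  nlinarith

/-! ### The gain conditions as definiteness of nested quadratic forms -/

namespace GridConverter

theorem Admissible.z_re_pos {P : GridConverter} (hP : P.Admissible) : 0 < P.z.re := by
  simpa [z] using hP.rg_pos

theorem Admissible.z_ne_zero {P : GridConverter} (hP : P.Admissible) : P.z ≠ 0 := by
  intro h
  have := hP.z_re_pos
  simp [h] at this

theorem Admissible.norm_y_pos {P : GridConverter} (hP : P.Admissible) : 0 < ‖P.y‖ := by
  simpa [y] using hP.z_ne_zero

/-- The reduced planar model at the equilibrium voltage `vs`. -/
noncomputable def planar (P : GridConverter) (vs : ℂ) : PlanarModel :=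
  ⟨-(P.sStar - P.rot * P.y + (P.α : ℂ)), P.α / P.vStar ^ 2, vs⟩

namespace StabilityConditions

variable {P : GridConverter} {vs : ℂ} {c₁ ε : ℝ}

theorem c₁_lt_planar_c (hc : P.StabilityConditions vs c₁ ε) : c₁ < (P.planar vs).c := by
  have h := hc.condA
  have h2 : P.α / P.vStar ^ 2 * ‖vs‖ ^ 2 / 2 = 1 / 2 * (P.α * ‖vs‖ ^ 2 / P.vStar ^ 2) := by ring
  simp only [planar, PlanarModel.c, Complex.neg_re, Complex.add_re, Complex.sub_re,
    Complex.ofReal_re]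
  rw [h2]
  linarith

theorem planar_norm_le (hP : P.Admissible) (hc : P.StabilityConditions vs c₁ ε) :
    ‖(P.planar vs).d‖ + 3 * ((P.planar vs).a * ‖(P.planar vs).v‖ ^ 2) ≤ P.cε vs ε := by
  have h1 := hP.vStar_pos
  have h2 := hP.α_nonneg
  have h3 : 0 ≤ P.α * ‖vs‖ ^ 2 / P.vStar ^ 2 := by positivity
  have h4 : P.α * ε * (‖vs‖ ^ 2 / P.vStar ^ 2) = ε * (P.α * ‖vs‖ ^ 2 / P.vStar ^ 2) := by ring
  have h5 : P.α / P.vStar ^ 2 * ‖vs‖ ^ 2 = P.α * ‖vs‖ ^ 2 / P.vStar ^ 2 := by ring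
  simp only [planar, norm_neg, cε]
  rw [h4, h5]
  nlinarith [hc.three_lt_ε]

theorem cε_pos (hP : P.Admissible) (hc : P.StabilityConditions vs c₁ ε) : 0 < P.cε vs ε := by
  have h1 := hc.planar_norm_le hP
  have h2 := hc.c₁_lt_planar_c
  have h3 := hc.c₁_pos
  have h4 : 0 ≤ (P.planar vs).a * ‖(P.planar vs).v‖ ^ 2 := by
    have := hP.α_nonneg
    have : 0 ≤ (P.planar vs).a := by simp only [planar]; positivity
    positivity
  have h5 := Complex.re_le_norm (P.planar vs).d
  unfold PlanarModel.c at h2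
  linarith

theorem β₂₁_pos (hP : P.Admissible) (hc : P.StabilityConditions vs c₁ ε) : 0 < P.β₂₁ vs ε := by
  have := hc.cε_pos hP
  have := hP.η_pos
  have := hP.lg_pos
  have := hP.rg_pos
  have := hP.norm_y_pos
  unfold β₂₁; positivity

theorem c₂_eq (P : GridConverter) (vs : ℂ) (c₁ ε : ℝ) : P.c₂ vs c₁ ε =
    minEigenvalue (P.β₂₁ vs ε * c₁) (1 - P.γ₂) (P.β₂₁ vs ε ^ 2) := by
  simp only [c₂, D₂, minEigenvalue, α₂, β₁₂, div_one]
  ring_nf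

theorem c₃_eq (P : GridConverter) (vs : ℂ) (c₁ ε : ℝ) : P.c₃ vs c₁ ε =
    minEigenvalue (P.β₃₂ / P.β₂₃ * P.c₂ vs c₁ ε) P.α₃ ((1 / 2 * P.β₃₁ vs ε) ^ 2 + P.β₃₂ ^ 2) := by
  simp only [c₃, D₃, minEigenvalue, γ₃, sub_zero]
  ring_nf

/-- Condition (b) says `γ₂ (c₁ + c_ε) < c₁`. As `β₂₁ = c_ε γ₂`, this is the determinant condition
`β₂₁² < β₂₁ c₁ (1 - γ₂)`. -/
theorem c₂_pos (hP : P.Admissible) (hc : P.StabilityConditions vs c₁ ε) : 0 < P.c₂ vs c₁ ε := by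
  have hcε := hc.cε_pos hP
  have hβ := hc.β₂₁_pos hP
  have hc1 := hc.c₁_pos
  have hg : 0 < P.lg / P.rg * ‖P.y‖ := by
    have := hP.lg_pos
    have := hP.rg_pos
    have := hP.norm_y_pos
    positivity
  have hB := hc.condB.2
  rw [lt_div_iff₀ (by positivity)] at hB
  have hγ : P.γ₂ = P.η * (P.lg / P.rg * ‖P.y‖) := by unfold γ₂; ring
  have hβγ : P.β₂₁ vs ε = P.cε vs ε * P.γ₂ := by unfold β₂₁ γ₂; ring
  have hkey : P.γ₂ * (c₁ + P.cε vs ε) < c₁ := by rw [hγ]; linarith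
  have hγ0 : 0 < P.γ₂ := by rw [hγ]; have := hP.η_pos; positivity
  have hγ1 : P.γ₂ < 1 := by nlinarith [mul_pos hγ0 hcε]
  rw [c₂_eq]
  refine minEigenvalue_pos (by positivity) (by linarith) ?_
  rw [sq, mul_assoc]
  refine mul_lt_mul_of_pos_left ?_ hβ
  rw [hβγ]
  linarith

theorem cf_lt_krv (hP : P.Admissible) (hc : P.StabilityConditions vs c₁ ε) : P.cf < P.krv := by
  have h1 := hP.krv_pos
  have h2 := hP.kpv_pos
  have h3 := (div_pos_iff_of_pos_left (by positivity)).1 hc.condC.1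
  rw [sub_pos, lt_div_iff₀ hP.cf_pos] at h3
  linarith

theorem lf_lt_krc (hP : P.Admissible) (hc : P.StabilityConditions vs c₁ ε) : P.lf < P.krc := by
  have h1 := hP.krc_pos
  have h2 := hP.kpc_pos
  have h3 := (div_pos_iff_of_pos_left (by positivity)).1 hc.condD.1
  rw [sub_pos, lt_div_iff₀ hP.lf_pos] at h3
  linarith

theorem c₃_pos (hP : P.Admissible) (hc : P.StabilityConditions vs c₁ ε) : 0 < P.c₃ vs c₁ ε := by
  have hcε := hc.cε_pos hP
  have hc2 := hc.c₂_pos hP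
  have hcf := hP.cf_pos
  have hkr := hP.krv_pos
  have hkp := hP.kpv_pos
  have hrg := hP.rg_pos
  have hη := hP.η_pos
  have hlt := hc.cf_lt_krv hP
  have hα : 0 < P.α₃ := by
    unfold α₃; rw [sub_pos, div_lt_one hkr]; exact hlt
  have hcv : 0 < P.cv := by unfold cv; positivity
  have hC := hc.condC.2
  -- The gain ratio in (c) is `c_v / α₃`, so (c) is the determinant condition for `c₃` up to a
  -- positive factor.
  have hfrac : (1 + P.krv / P.kpv) / (P.krv / P.cf - 1) = P.cv / P.α₃ := by
    have h1 : P.krv - P.cf ≠ 0 := by linarith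
    have h2 : P.krv / P.cf - 1 ≠ 0 := by
      rw [div_sub_one hcf.ne']; exact div_ne_zero h1 hcf.ne'
    rw [div_eq_div_iff h2 hα.ne']
    unfold cv α₃
    field_simp
    ring
  rw [hfrac, div_lt_div_iff₀ hα (by positivity)] at hC
  rw [c₃_eq]
  have hx : P.β₃₂ / P.β₂₃ = P.cv * P.η * P.rg := by unfold β₃₂ β₂₃; field_simp
  rw [hx]
  refine minEigenvalue_pos (by positivity) hα ?_
  have h1 : (1 / 2 * P.β₃₁ vs ε) ^ 2 + P.β₃₂ ^ 2
      = P.cv * P.η * P.rg / 4 * (P.cv * (1 / P.rg * P.η * (P.cε vs ε ^ 2 + 4))) := by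
    unfold β₃₁ β₃₂
    field_simp
    ring
  have h2 : P.cv * P.η * P.rg * P.c₂ vs c₁ ε * P.α₃
      = P.cv * P.η * P.rg / 4 * (4 * P.c₂ vs c₁ ε * P.α₃) := by ring
  rw [h1, h2]
  gcongr

theorem c₃_lt_one (hP : P.Admissible) (vs : ℂ) (c₁ ε : ℝ) : P.c₃ vs c₁ ε < 1 := by
  have h1 : P.α₃ < 1 := by
    unfold α₃
    have := div_pos hP.cf_pos hP.krv_pos
    linarith
  rw [c₃_eq]
  exact (minEigenvalue_le (by positivity)).trans_lt h1

end StabilityConditions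

/-- The gain from the capacitor layer to the current reference, in terms of the Euclidean norm of
`(v - v̂, ζᵥ)`; it is bounded by `β₄₃t`. -/
noncomputable def capGain (P : GridConverter) : ℝ :=
  1 / P.lg + (P.γ₄t * √(P.kpv ^ 2 + P.krv ^ 2) + P.krv)

/-- Storage gain `l_f / k_p^c + l_f / k_r^c` of the current loop. -/
noncomputable def cc (P : GridConverter) : ℝ := P.lf / P.kpc + P.lf / P.krc

theorem cc_pos {P : GridConverter} (hP : P.Admissible) : 0 < P.cc := by
  have := hP.lf_pos
  have := hP.kpc_pos
  have := hP.krc_pos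
  unfold cc; positivity

theorem γ₄t_nonneg {P : GridConverter} (hP : P.Admissible) : 0 ≤ P.γ₄t := by
  have := hP.cf_pos
  unfold γ₄t; positivity

theorem β₄₃t_eq (P : GridConverter) :
    P.β₄₃t = 1 / P.lg + (P.γ₄t * (P.kpv + P.krv) + P.krv) := by
  unfold β₄₃t γ₄t; ring

theorem capGain_pos {P : GridConverter} (hP : P.Admissible) : 0 < P.capGain := by
  have := hP.lg_pos
  have := hP.krv_pos
  have := γ₄t_nonneg hP
  unfold capGain; positivity

/-- The constant `β₄₃t` uses `kpv + krv` where `√(kpv² + krv²)` suffices. The slack is at least `kpv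
krv / (kpv + krv) = 1 / β₃₄`, and `outer_margin` needs it. -/
theorem capGain_add_le {P : GridConverter} (hP : P.Admissible) :
    P.capGain + P.γ₄t / P.β₃₄ ≤ P.β₄₃t := by
  have hp := hP.kpv_pos
  have hr := hP.krv_pos
  have hγ := γ₄t_nonneg hP
  have hβ : P.β₃₄ = (P.kpv + P.krv) / (P.kpv * P.krv) := by unfold β₃₄; field_simp; ring
  have hs : √(P.kpv ^ 2 + P.krv ^ 2) ≤ P.kpv + P.krv - P.kpv * P.krv / (P.kpv + P.krv) := by
    have h1 : P.kpv + P.krv - P.kpv * P.krv / (P.kpv + P.krv)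
        = (P.kpv ^ 2 + P.kpv * P.krv + P.krv ^ 2) / (P.kpv + P.krv) := by field_simp; ring
    rw [h1]
    refine Real.sqrt_le_iff.2 ⟨by positivity, ?_⟩
    rw [div_pow, le_div_iff₀ (by positivity)]
    nlinarith [sq_nonneg (P.kpv * P.krv)]
  have h2 : P.γ₄t / P.β₃₄ = P.γ₄t * (P.kpv * P.krv / (P.kpv + P.krv)) := by
    rw [hβ]; field_simp
  rw [h2, β₄₃t_eq, capGain]
  nlinarith [mul_le_mul_of_nonneg_left hs hγ]

namespace StabilityConditions

variable {P : GridConverter} {vs : ℂ} {c₁ ε : ℝ}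

/-- With `2 β₄₃t` in place of `β₄₃t + capGain`, definiteness would require `4 c₃ γ₄t` in the
denominator of (d), which has only `c₃ γ₄t`. The missing `3 c₃ γ₄t` comes from the slack in
`capGain_add_le`. -/
theorem outer_margin (hP : P.Admissible) (hc : P.StabilityConditions vs c₁ ε) :
    P.cc ^ 2 * (P.β₄₁t vs ε ^ 2 + P.β₄₂t ^ 2 + (P.β₄₃t + P.capGain) ^ 2) / 4
      < (P.cc * P.β₄₃t / P.β₃₄ * P.c₃ vs c₁ ε) * ((1 - P.lf / P.krc) - P.cc * P.γ₄t) := by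
  have hlf := hP.lf_pos
  have hkr := hP.krc_pos
  have hkp := hP.kpc_pos
  have hlt := hc.lf_lt_krc hP
  have hc3 := hc.c₃_pos hP
  have hc31 := c₃_lt_one hP vs c₁ ε
  have hcc := cc_pos hP
  have hγ := γ₄t_nonneg hP
  have hg := capGain_pos hP
  have hb34 : 0 < P.β₃₄ := by
    have := hP.kpv_pos
    have := hP.krv_pos
    unfold β₃₄; positivity
  have hle := capGain_add_le hP
  have hb43 : 0 < P.β₄₃t := by
    have : 0 ≤ P.γ₄t / P.β₃₄ := by positivity
    linarith
  have hα : 0 < 1 - P.lf / P.krc := by rw [sub_pos, div_lt_one hkr]; exact hlt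
  have hfrac : (1 + P.krc / P.kpc) / (P.krc / P.lf - 1) = P.cc / (1 - P.lf / P.krc) := by
    have h1 : P.krc - P.lf ≠ 0 := by linarith
    have h2 : P.krc / P.lf - 1 ≠ 0 := by
      rw [div_sub_one hlf.ne']; exact div_ne_zero h1 hlf.ne'
    rw [div_eq_div_iff h2 hα.ne']
    unfold cc
    field_simp
    ring
  have hD := hc.condD.2
  rw [hfrac, div_lt_div_iff₀ hα (by positivity)] at hD
  set g := P.γ₄t
  set b := P.β₄₃t
  set b' := P.capGain
  set c3 := P.c₃ vs c₁ ε
  set X := P.β₄₁t vs ε ^ 2 + P.β₄₂t ^ 2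
  set α := 1 - P.lf / P.krc
  set β := P.β₃₄
  -- Here `c₃ < 1` turns the slack `γ₄t / β₃₄` into `c₃ γ₄t / β₃₄`.
  have h1 : b * (g * c3 / β) ≤ b * (b - b') := by
    have : g * c3 / β ≤ g / β := by
      gcongr
      nlinarith
    gcongr
    linarith
  have h0 : 0 ≤ b - b' := by
    have : 0 ≤ g / β := by positivity
    linarith
  -- Since `0 ≤ b - b' ≤ b`, `(b + b')² = 4b² - 4b(b - b') + (b - b')² ≤ 4b² - 3b(b - b')`.
  have h2 : (b + b') ^ 2 ≤ 4 * b ^ 2 - 3 * (b * (g * c3 / β)) := by nlinarith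
  have h3 : P.cc * b / (4 * β) * (P.cc * (β / b * (X + 4 * b ^ 2) + c3 * g))
      < P.cc * b / (4 * β) * (4 * c3 * α) := by gcongr
  have h4 : P.cc * b / (4 * β) * (P.cc * (β / b * (X + 4 * b ^ 2) + c3 * g))
      = P.cc ^ 2 * (X + 4 * b ^ 2 + b * (g * c3 / β)) / 4 := by field_simp
  have h5 : P.cc * b / (4 * β) * (4 * c3 * α) = P.cc * b / β * c3 * α := by field_simp
  have h6 : P.cc * b / β * c3 * (α - P.cc * g)
      = P.cc * b / β * c3 * α - P.cc ^ 2 * (b * (g * c3 / β)) := by field_simp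
  rw [h4, h5] at h3
  rw [h6]
  have h7 : P.cc ^ 2 * (X + (b + b') ^ 2)
      ≤ P.cc ^ 2 * (X + (4 * b ^ 2 - 3 * (b * (g * c3 / β)))) := by
    gcongr
  linarith

/-- The weighted sum of the four layer inequalities is negative definite in the magnitudes. -/
theorem exists_rate (hP : P.Admissible) (hc : P.StabilityConditions vs c₁ ε) :
    ∃ k > 0, ∀ ψ₁ ψ₂ ψ₃ ψ₄ v₁ v₂ v₃ v₄ : ℝ, 0 ≤ ψ₁ → 0 ≤ ψ₂ → 0 ≤ ψ₃ → 0 ≤ ψ₄ →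
      v₁ ≤ -c₁ * ψ₁ ^ 2 + ψ₁ * ψ₂ →
      v₂ ≤ -ψ₂ ^ 2 + 1 / P.rg * ψ₂ * ψ₃
        + P.lg / P.rg * ‖P.y‖ * ψ₂ * (P.η * (P.cε vs ε * ψ₁ + ψ₂)) →
      v₃ ≤ -P.α₃ * ψ₃ ^ 2 + P.cv * ψ₃ * (ψ₄ / P.cf + P.η * (P.cε vs ε * ψ₁ + ψ₂)) →
      v₄ ≤ -(1 - P.lf / P.krc) * ψ₄ ^ 2 + P.cc * ψ₄ *
        (P.β₄₁t vs ε * ψ₁ + P.β₄₂t * ψ₂ + P.capGain * ψ₃ + P.γ₄t * ψ₄) →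
      P.cc * P.β₄₃t / P.β₃₄ * (P.β₃₂ / P.β₂₃ * (P.β₂₁ vs ε * v₁ + v₂) + v₃) + v₄
        ≤ -k * (ψ₁ ^ 2 + ψ₂ ^ 2 + ψ₃ ^ 2 + ψ₄ ^ 2) := by
  have hm := hc.outer_margin hP
  have hcε := hc.cε_pos hP
  have hb21 := hc.β₂₁_pos hP
  have hc2 := hc.c₂_pos hP
  have hc3 := hc.c₃_pos hP
  have hcc := cc_pos hP
  have hrg := hP.rg_pos
  have hlg := hP.lg_pos
  have hη := hP.η_pos
  have hkp := hP.kpv_pos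
  have hkr := hP.krv_pos
  have hcf := hP.cf_pos
  have hg := capGain_pos hP
  have hγ := γ₄t_nonneg hP
  have hb34 : 0 < P.β₃₄ := by unfold β₃₄; positivity
  have hb43 : 0 < P.β₄₃t := by
    have : 0 ≤ P.γ₄t / P.β₃₄ := by positivity
    linarith [capGain_add_le hP]
  have hcv : 0 < P.cv := by unfold cv; positivity
  have hb32 : P.β₃₂ / P.β₂₃ = P.cv * P.η * P.rg := by unfold β₃₂ β₂₃; field_simp
  set p := P.cc * P.β₄₃t / P.β₃₄ * P.c₃ vs c₁ ε with hp
  set q := (1 - P.lf / P.krc) - P.cc * P.γ₄t with hq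
  set B := P.cc ^ 2 * (P.β₄₁t vs ε ^ 2 + P.β₄₂t ^ 2 + (P.β₄₃t + P.capGain) ^ 2) / 4 with hB
  have hp0 : 0 < p := by positivity
  have hB0 : 0 ≤ B := by positivity
  have hq0 : 0 < q := pos_of_mul_pos_right (hB0.trans_lt hm) hp0.le
  refine ⟨minEigenvalue p q B, minEigenvalue_pos hp0 hq0 hm, ?_⟩
  intro ψ₁ ψ₂ ψ₃ ψ₄ v₁ v₂ v₃ v₄ h1 h2 h3 h4 hv1 hv2 hv3 hv4
  have e2 : P.β₂₁ vs ε * v₁ + v₂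
      ≤ -P.c₂ vs c₁ ε * (ψ₁ ^ 2 + ψ₂ ^ 2) + 1 / P.rg * ψ₂ * ψ₃ := by
    have h := minEigenvalue_mul_le (p := P.β₂₁ vs ε * c₁) (q := 1 - P.γ₂) (B := P.β₂₁ vs ε ^ 2)
      (S := ψ₁ ^ 2) (T := P.β₂₁ vs ε * ψ₁) (y := ψ₂) (by positivity) (by positivity)
      (by rw [mul_pow])
    rw [← c₂_eq] at h
    have h5 := mul_le_mul_of_nonneg_left hv1 hb21.le
    have h6 : P.lg / P.rg * ‖P.y‖ * ψ₂ * (P.η * (P.cε vs ε * ψ₁ + ψ₂))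
        = P.β₂₁ vs ε * ψ₁ * ψ₂ + P.γ₂ * ψ₂ ^ 2 := by unfold β₂₁ γ₂; ring
    rw [h6] at hv2
    linarith
  have e3 : P.β₃₂ / P.β₂₃ * (P.β₂₁ vs ε * v₁ + v₂) + v₃
      ≤ -P.c₃ vs c₁ ε * (ψ₁ ^ 2 + ψ₂ ^ 2 + ψ₃ ^ 2) + P.β₃₄ * ψ₃ * ψ₄ := by
    have h := minEigenvalue_mul_le (p := P.β₃₂ / P.β₂₃ * P.c₂ vs c₁ ε) (q := P.α₃)
      (B := (1 / 2 * P.β₃₁ vs ε) ^ 2 + P.β₃₂ ^ 2)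
      (S := ψ₁ ^ 2 + ψ₂ ^ 2) (T := 1 / 2 * P.β₃₁ vs ε * ψ₁ + P.β₃₂ * ψ₂) (y := ψ₃)
      (by positivity) (by positivity)
      (by nlinarith [sq_nonneg (1 / 2 * P.β₃₁ vs ε * ψ₂ - P.β₃₂ * ψ₁)])
    rw [← c₃_eq] at h
    have h5 := mul_le_mul_of_nonneg_left e2 (by rw [hb32]; positivity : 0 ≤ P.β₃₂ / P.β₂₃)
    have h6 : P.β₃₂ / P.β₂₃ * (1 / P.rg * ψ₂ * ψ₃) = P.β₃₂ * ψ₂ * ψ₃ := by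
      unfold β₂₃; field_simp
    have h7 : P.cv * ψ₃ * (ψ₄ / P.cf + P.η * (P.cε vs ε * ψ₁ + ψ₂))
        = P.β₃₄ * ψ₃ * ψ₄ + P.β₃₁ vs ε * ψ₁ * ψ₃ + P.β₃₂ * ψ₂ * ψ₃ := by
      unfold β₃₄ β₃₁ β₃₂ cv; field_simp; ring
    rw [mul_add (P.β₃₂ / P.β₂₃) (-P.c₂ vs c₁ ε * _), h6] at h5
    rw [h7] at hv3
    linarith
  -- The product `ψ₃ ψ₄` enters twice: with `cc β₄₃t` from the weighted inner layers and with `cc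
  -- capGain` from the fourth layer.
  have h := minEigenvalue_mul_le (p := p) (q := q) (B := B) (S := ψ₁ ^ 2 + ψ₂ ^ 2 + ψ₃ ^ 2)
    (T := P.cc / 2 * (P.β₄₁t vs ε * ψ₁ + P.β₄₂t * ψ₂ + (P.β₄₃t + P.capGain) * ψ₃)) (y := ψ₄)
    hB0 (by positivity) (by
      rw [mul_pow, hB]
      have := mul_le_mul_of_nonneg_left (sq_sum_three_le (P.β₄₁t vs ε) P.β₄₂t
        (P.β₄₃t + P.capGain) ψ₁ ψ₂ ψ₃) (sq_nonneg P.cc)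
      linarith)
  have h5 := mul_le_mul_of_nonneg_left e3
    (by positivity : 0 ≤ P.cc * P.β₄₃t / P.β₃₄)
  have h6 : P.cc * P.β₄₃t / P.β₃₄ * (P.β₃₄ * ψ₃ * ψ₄) = P.cc * P.β₄₃t * ψ₃ * ψ₄ := by
    field_simp
  rw [mul_add (P.cc * P.β₄₃t / P.β₃₄) (-P.c₃ vs c₁ ε * _), h6] at h5
  rw [hp, hq] at h
  rw [hp, hq]
  linarith

end StabilityConditions

end GridConverter

/-! ### Linearity of the state components -/

namespace ConverterState

variable (u w : ConverterState) (r : ℝ)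

theorem vHat_add : (u + w).vHat = u.vHat + w.vHat := rfl
theorem iOut_add : (u + w).iOut = u.iOut + w.iOut := rfl
theorem vCap_add : (u + w).vCap = u.vCap + w.vCap := rfl
theorem ζv_add : (u + w).ζv = u.ζv + w.ζv := rfl
theorem iInd_add : (u + w).iInd = u.iInd + w.iInd := rfl
theorem ζc_add : (u + w).ζc = u.ζc + w.ζc := rfl

theorem vHat_smul : (r • u).vHat = r • u.vHat := rfl
theorem iOut_smul : (r • u).iOut = r • u.iOut := rfl
theorem vCap_smul : (r • u).vCap = r • u.vCap := rfl
theorem ζv_smul : (r • u).ζv = r • u.ζv := rfl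
theorem iInd_smul : (r • u).iInd = r • u.iInd := rfl
theorem ζc_smul : (r • u).ζc = r • u.ζc := rfl

end ConverterState

namespace GridConverter

open ConverterState

/-! ### Error coordinates -/

/-- The state in coordinates in which every layer is measured from its quasi-steady state. -/
noncomputable def errors (P : GridConverter) (vs : ℂ) (x : ConverterState) : ConverterState :=
  (x.vHat - vs, x.iOut - P.y * (x.vHat - P.vg), (x.vCap - x.vHat, x.ζv), (x.iInd - P.iRef x, x.ζc))

/-- The linear inverse of the change to error coordinates. -/
noncomputable def ofErrors (P : GridConverter) : ConverterState →L[ℝ] ConverterState :=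
  LinearMap.toContinuousLinearMap
    { toFun := fun u => (u.vHat, u.iOut + P.y * u.vHat, (u.vCap + u.vHat, u.ζv),
        (u.iInd + (-(P.kpv : ℂ) * u.vCap - (P.krv : ℂ) * u.ζv + P.yf * (u.vCap + u.vHat)
          + (u.iOut + P.y * u.vHat)), u.ζc))
      map_add' := fun u w => by
        simp only [vHat_add, iOut_add, vCap_add, ζv_add, iInd_add, ζc_add,
          Prod.mk_add_mk, Prod.mk.injEq, true_and, and_true]
        refine ⟨?_, ?_, ?_⟩ <;> ring
      map_smul' := fun r u => by
        simp only [vHat_smul, iOut_smul, vCap_smul, ζv_smul, iInd_smul, ζc_smul,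
          Prod.smul_mk, Prod.mk.injEq, RingHom.id_apply, Complex.real_smul, true_and, and_true]
        refine ⟨?_, ?_, ?_⟩ <;> ring }

/-- The sum of the squared moduli of the six components. -/
noncomputable def energy (u : ConverterState) : ℝ :=
  ‖u.vHat‖ ^ 2 + ‖u.iOut‖ ^ 2 + (‖u.vCap‖ ^ 2 + ‖u.ζv‖ ^ 2) + (‖u.iInd‖ ^ 2 + ‖u.ζc‖ ^ 2)

theorem norm_le_sqrt_energy (u : ConverterState) : ‖u‖ ≤ √(energy u) := by
  have h : ∀ s : ℝ, s ^ 2 ≤ energy u → s ≤ √(energy u) := fun s hs => Real.le_sqrt_of_sq_le hs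
  have h1 := sq_nonneg ‖u.vHat‖
  have h2 := sq_nonneg ‖u.iOut‖
  have h3 := sq_nonneg ‖u.vCap‖
  have h4 := sq_nonneg ‖u.ζv‖
  have h5 := sq_nonneg ‖u.iInd‖
  have h6 := sq_nonneg ‖u.ζc‖
  simp only [norm_prod_le_iff]
  refine ⟨h _ ?_, h _ ?_, ⟨h _ ?_, h _ ?_⟩, h _ ?_, h _ ?_⟩ <;> unfold energy <;> linarith

section Equilibrium

variable {P : GridConverter} {xs : ConverterState}

theorem equilibrium_relations (hP : P.Admissible) (hω : P.ωΔ = 0) (hxs : P.field xs = 0) :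
    P.errors xs.vHat xs = 0 := by
  have hcf : (P.cf : ℂ) ≠ 0 := by exact_mod_cast hP.cf_pos.ne'
  have hlf : (P.lf : ℂ) ≠ 0 := by exact_mod_cast hP.lf_pos.ne'
  have hlg : (P.lg : ℂ) ≠ 0 := by exact_mod_cast hP.lg_pos.ne'
  have hkrv : (P.krv : ℂ) ≠ 0 := by exact_mod_cast hP.krv_pos.ne'
  have hkrc : (P.krc : ℂ) ≠ 0 := by exact_mod_cast hP.krc_pos.ne'
  have hz := hP.z_ne_zero
  simp only [field, Prod.mk_eq_zero, f₂, f₃, f₄, hω, Complex.ofReal_zero, mul_zero, zero_mul,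
    zero_add, mul_eq_zero, inv_eq_zero, hcf, hlf, hlg, false_or] at hxs
  obtain ⟨-, h2, ⟨h3, h4⟩, h5, h6⟩ := hxs
  rw [h6, mul_zero, zero_sub, neg_eq_zero, mul_eq_zero, or_iff_right hkrc] at h5
  -- Putting `i_f = i_f⋆` and `v = v̂` into the capacitor balance leaves only `krv ζᵥ = 0`.
  have hζ : xs.ζv = 0 := by
    have : (P.krv : ℂ) * xs.ζv = 0 := by
      have h7 := h6
      unfold iRef at h7
      linear_combination h7 - h3 - (P.kpv : ℂ) * h4
    exact (mul_eq_zero.1 this).resolve_left hkrv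
  have hi : xs.iOut - P.y * (xs.vHat - P.vg) = 0 := by
    have : P.z * xs.iOut = xs.vHat - P.vg := by linear_combination h4 - h2
    rw [← this, y, inv_mul_cancel_left₀ hz, sub_self]
  simp only [errors, sub_self, hi, h4, hζ, h6, h5]
  rfl

theorem sub_eq_ofErrors (he : P.errors xs.vHat xs = 0) (x : ConverterState) :
    x - xs = P.ofErrors (P.errors xs.vHat x) := by
  simp only [errors, Prod.mk_eq_zero] at he
  obtain ⟨-, h2, ⟨h3, h4⟩, h5, h6⟩ := he
  unfold iRef at h5
  refine Prod.ext rfl (Prod.ext ?_ (Prod.ext (Prod.ext ?_ ?_) (Prod.ext ?_ ?_)))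
  · change x.iOut - xs.iOut
      = x.iOut - P.y * (x.vHat - P.vg) + P.y * (x.vHat - xs.vHat)
    linear_combination -h2
  · change x.vCap - xs.vCap = x.vCap - x.vHat + (x.vHat - xs.vHat)
    linear_combination -h3
  · change x.ζv - xs.ζv = x.ζv
    linear_combination -h4
  · change x.iInd - xs.iInd = x.iInd - P.iRef x
      + (-(P.kpv : ℂ) * (x.vCap - x.vHat) - (P.krv : ℂ) * x.ζv
        + P.yf * (x.vCap - x.vHat + (x.vHat - xs.vHat))
        + (x.iOut - P.y * (x.vHat - P.vg) + P.y * (x.vHat - xs.vHat)))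
    unfold iRef
    linear_combination -h5 - h2 + (P.kpv : ℂ) * h3 + (P.krv : ℂ) * h4 - P.yf * h3
  · change x.ζc - xs.ζc = x.ζc
    linear_combination -h6

theorem norm_sub_sq_le (he : P.errors xs.vHat xs = 0) (x : ConverterState) :
    ‖x - xs‖ ^ 2 ≤ (‖P.ofErrors‖ ^ 2 + 1) * energy (P.errors xs.vHat x) := by
  set u := P.errors xs.vHat x
  have hE : 0 ≤ energy u := by unfold energy; positivity
  have h1 : ‖x - xs‖ ≤ ‖P.ofErrors‖ * √(energy u) := by
    rw [sub_eq_ofErrors he]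
    refine (P.ofErrors.le_opNorm _).trans ?_
    gcongr
    exact norm_le_sqrt_energy u
  calc ‖x - xs‖ ^ 2 ≤ (‖P.ofErrors‖ * √(energy u)) ^ 2 := by gcongr
    _ = ‖P.ofErrors‖ ^ 2 * energy u := by rw [mul_pow, Real.sq_sqrt hE]
    _ ≤ _ := by gcongr; linarith

/-! ### The vector field in error coordinates -/

/-- Subtract the equilibrium equation. Replacing `i` by its quasi-steady value adds `-Y` to the
linear part, which gives the planar model. -/
theorem f₁_eq (hP : P.Admissible) (hω : P.ωΔ = 0) (hxs : P.field xs = 0) (x : ConverterState) :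
    P.f₁ x = -((P.η : ℂ) * (P.planar xs.vHat).F (P.errors xs.vHat x).vHat)
      - (P.η : ℂ) * P.rot * (P.errors xs.vHat x).iOut := by
  have he := equilibrium_relations hP hω hxs
  have h1 : P.f₁ xs = 0 := congrArg Prod.fst hxs
  simp only [errors, Prod.mk_eq_zero] at he
  have h2 := he.2.1
  have hamp : ∀ w : ℂ, P.ampReg w = 1 - ‖w‖ ^ 2 / P.vStar ^ 2 := fun w => by
    rw [ampReg, sub_div, div_self (pow_ne_zero 2 hP.vStar_pos.ne')]
  have hx : xs.vHat + (x.vHat - xs.vHat) = x.vHat := by ring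
  simp only [f₁, hω, hamp, errors, PlanarModel.F, planar, cubicDiff, hx] at h1 ⊢
  push_cast at h1 ⊢
  linear_combination h1 + (P.η : ℂ) * P.rot * h2

theorem f₂_eq (hP : P.Admissible) (vs : ℂ) (x : ConverterState) :
    P.f₂ x = (P.lg : ℂ)⁻¹ * (-P.z * (P.errors vs x).iOut + (P.errors vs x).vCap) := by
  have hz : P.z * P.y = 1 := by rw [y, mul_inv_cancel₀ hP.z_ne_zero]
  simp only [f₂, errors]
  linear_combination (-(P.lg : ℂ)⁻¹ * (x.vHat - P.vg)) * hz

theorem f₃_eq (hω : P.ωΔ = 0) (vs : ℂ) (x : ConverterState) :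
    P.f₃ x = ((P.cf : ℂ)⁻¹ * (-(P.kpv : ℂ) * (P.errors vs x).vCap
      - (P.krv : ℂ) * (P.errors vs x).ζv + (P.errors vs x).iInd), (P.errors vs x).vCap) := by
  simp only [f₃, errors, iRef, hω, Prod.mk.injEq]
  constructor
  · ring
  · simp

theorem f₄_eq (hω : P.ωΔ = 0) (vs : ℂ) (x : ConverterState) :
    P.f₄ x = ((P.lf : ℂ)⁻¹ * (-(P.kpc : ℂ) * (P.errors vs x).iInd
      - (P.krc : ℂ) * (P.errors vs x).ζc), (P.errors vs x).iInd) := by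
  simp only [f₄, errors, hω, Prod.mk.injEq, true_and]
  simp

/-- The reference is linear in the state, so `iRef (field x)` is its velocity, the disturbance
acting on the current loop. -/
theorem norm_iRef_field_le (hP : P.Admissible) (hω : P.ωΔ = 0) (vs : ℂ) (x : ConverterState) :
    ‖P.iRef (P.field x)‖ ≤ P.kpv * ‖P.f₁ x‖ + ‖P.z‖ / P.lg * ‖(P.errors vs x).iOut‖
      + P.capGain * √(‖(P.errors vs x).vCap‖ ^ 2 + ‖(P.errors vs x).ζv‖ ^ 2)
      + P.γ₄t * ‖(P.errors vs x).iInd‖ := by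
  have hkp := hP.kpv_pos
  have hkr := hP.krv_pos
  have hcf := hP.cf_pos
  have hlg := hP.lg_pos
  set u := P.errors vs x with hu
  set ψ := √(‖u.vCap‖ ^ 2 + ‖u.ζv‖ ^ 2) with hψ
  have he : ‖u.vCap‖ ≤ ψ := Real.le_sqrt_of_sq_le (by nlinarith [sq_nonneg ‖u.ζv‖])
  have hpr : ‖-(P.kpv : ℂ) * u.vCap - (P.krv : ℂ) * u.ζv‖ ≤ √(P.kpv ^ 2 + P.krv ^ 2) * ψ := by
    rw [hψ, ← Real.sqrt_mul (by positivity)]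
    refine Real.le_sqrt_of_sq_le ?_
    have h1 : ‖-(P.kpv : ℂ) * u.vCap - (P.krv : ℂ) * u.ζv‖
        ≤ P.kpv * ‖u.vCap‖ + P.krv * ‖u.ζv‖ := by
      refine (norm_sub_le _ _).trans ?_
      rw [norm_mul, norm_mul, norm_neg, Complex.norm_of_nonneg hkp.le,
        Complex.norm_of_nonneg hkr.le]
    calc _ ≤ (P.kpv * ‖u.vCap‖ + P.krv * ‖u.ζv‖) ^ 2 := by gcongr
      _ ≤ _ := by linarith [sq_nonneg (P.kpv * ‖u.ζv‖ - P.krv * ‖u.vCap‖)]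
  have hsplit : P.iRef (P.field x)
      = (P.yf - P.kpv) * ((P.cf : ℂ)⁻¹ * ((-(P.kpv : ℂ) * u.vCap - (P.krv : ℂ) * u.ζv) + u.iInd))
        + (P.kpv : ℂ) * P.f₁ x + (-(P.krv : ℂ)) * u.vCap
        + (P.lg : ℂ)⁻¹ * (-P.z * u.iOut + u.vCap) := by
    simp only [iRef, field, f₂_eq hP vs, f₃_eq hω vs, ← hu]
    ring
  have n1 : ‖(P.yf - P.kpv) * ((P.cf : ℂ)⁻¹ * ((-(P.kpv : ℂ) * u.vCap - (P.krv : ℂ) * u.ζv)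
      + u.iInd))‖ ≤ P.γ₄t * (√(P.kpv ^ 2 + P.krv ^ 2) * ψ + ‖u.iInd‖) := by
    rw [norm_mul, norm_mul, norm_inv, Complex.norm_of_nonneg hcf.le, ← mul_assoc,
      ← div_eq_mul_inv]
    refine mul_le_mul_of_nonneg_left ((norm_add_le _ _).trans ?_) (by positivity)
    gcongr
  have n2 : ‖(P.kpv : ℂ) * P.f₁ x‖ = P.kpv * ‖P.f₁ x‖ := by
    rw [norm_mul, Complex.norm_of_nonneg hkp.le]
  have n3 : ‖(-(P.krv : ℂ)) * u.vCap‖ ≤ P.krv * ψ := by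
    rw [norm_mul, norm_neg, Complex.norm_of_nonneg hkr.le]
    gcongr
  have n4 : ‖(P.lg : ℂ)⁻¹ * (-P.z * u.iOut + u.vCap)‖
      ≤ ‖P.z‖ / P.lg * ‖u.iOut‖ + 1 / P.lg * ψ := by
    rw [norm_mul, norm_inv, Complex.norm_of_nonneg hlg.le]
    calc P.lg⁻¹ * ‖-P.z * u.iOut + u.vCap‖ ≤ P.lg⁻¹ * (‖P.z‖ * ‖u.iOut‖ + ψ) := by
          refine mul_le_mul_of_nonneg_left ((norm_add_le _ _).trans ?_) (by positivity)
          rw [norm_mul, norm_neg]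
          gcongr
      _ = _ := by ring
  have hsum : ‖P.iRef (P.field x)‖ ≤ P.γ₄t * (√(P.kpv ^ 2 + P.krv ^ 2) * ψ + ‖u.iInd‖)
      + P.kpv * ‖P.f₁ x‖ + P.krv * ψ + (‖P.z‖ / P.lg * ‖u.iOut‖ + 1 / P.lg * ψ) := by
    rw [hsplit]
    refine (norm_add_le _ _).trans (add_le_add ((norm_add_le _ _).trans (add_le_add
      ((norm_add_le _ _).trans (add_le_add n1 n2.le)) n3)) n4)
  unfold capGain
  linarith

end Equilibrium

/-! ### The Lyapunov function of the full-order system -/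

/-- The nested Lyapunov function. -/
noncomputable def lyapunov (P : GridConverter) (vs : ℂ) (ε : ℝ) (x : ConverterState) : ℝ :=
  let u := P.errors vs x
  P.cc * P.β₄₃t / P.β₃₄ * (P.β₃₂ / P.β₂₃ * (P.β₂₁ vs ε * ((P.planar vs).storage u.vHat / P.η)
    + P.lg / P.rg * (‖u.iOut‖ ^ 2 / 2)) + loopStorage P.cf P.kpv P.krv u.vCap u.ζv)
    + loopStorage P.lf P.kpc P.krc u.iInd u.ζc

/-- The directional derivative of `lyapunov`. -/
noncomputable def lyapunovDeriv (P : GridConverter) (vs : ℂ) (ε : ℝ) (x w : ConverterState) : ℝ :=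
  let u := P.errors vs x
  P.cc * P.β₄₃t / P.β₃₄ * (P.β₃₂ / P.β₂₃ *
    (P.β₂₁ vs ε * (inner ℝ ((P.planar vs).grad u.vHat) w.vHat / P.η)
      + P.lg / P.rg * inner ℝ u.iOut (w.iOut - P.y * w.vHat))
    + loopStorageDeriv P.cf P.kpv P.krv u.vCap u.ζv (w.vCap - w.vHat) w.ζv)
    + loopStorageDeriv P.lf P.kpc P.krc u.iInd u.ζc (w.iInd - P.iRef w) w.ζc

theorem lyapunovDeriv_smul (P : GridConverter) (vs : ℂ) (ε : ℝ) (x w : ConverterState) (r : ℝ) :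
    P.lyapunovDeriv vs ε x (r • w) = r * P.lyapunovDeriv vs ε x w := by
  have h1 : P.iRef (r • w) = r • P.iRef w := by
    simp only [iRef, vHat_smul, iOut_smul, vCap_smul, ζv_smul, Complex.real_smul]
    ring
  have h2 : P.y * (r • w.vHat) = r • (P.y * w.vHat) := mul_smul_comm _ _ _
  simp only [lyapunovDeriv, loopStorageDeriv, vHat_smul, iOut_smul, vCap_smul,
    ζv_smul, iInd_smul, ζc_smul, h1, h2, ← smul_sub,
    real_inner_smul_right]
  ring

theorem hasDerivWithinAt_lyapunov (P : GridConverter) (vs : ℂ) (ε : ℝ) {γ : ℝ → ConverterState}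
    {w : ConverterState} {s : Set ℝ} {t : ℝ} (h : HasDerivWithinAt γ w s t) :
    HasDerivWithinAt (fun τ => P.lyapunov vs ε (γ τ)) (P.lyapunovDeriv vs ε (γ t) w) s t := by
  have d1 : HasDerivWithinAt (fun τ => (γ τ).vHat) w.vHat s t := h.fst
  have d2 : HasDerivWithinAt (fun τ => (γ τ).iOut) w.iOut s t := h.snd.fst
  have d3 : HasDerivWithinAt (fun τ => (γ τ).vCap) w.vCap s t := h.snd.snd.fst.fst
  have d4 : HasDerivWithinAt (fun τ => (γ τ).ζv) w.ζv s t := h.snd.snd.fst.snd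
  have d5 : HasDerivWithinAt (fun τ => (γ τ).iInd) w.iInd s t := h.snd.snd.snd.fst
  have d6 : HasDerivWithinAt (fun τ => (γ τ).ζc) w.ζc s t := h.snd.snd.snd.snd
  have dr : HasDerivWithinAt (fun τ => P.iRef (γ τ)) (P.iRef w) s t :=
    ((((d3.sub d1).const_mul (-(P.kpv : ℂ))).sub (d4.const_mul (P.krv : ℂ))).add
      (d3.const_mul P.yf)).add d2
  have s1 := PlanarModel.hasDerivWithinAt_storage (M := P.planar vs) (d1.sub_const vs)
  have s2 := (d2.sub ((d1.sub_const (P.vg : ℂ)).const_mul P.y)).norm_sq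
  have s3 := hasDerivWithinAt_loopStorage P.cf P.kpv P.krv (d3.sub d1) d4
  have s4 := hasDerivWithinAt_loopStorage P.lf P.kpc P.krc (d5.sub dr) d6
  have s5 := ((((((s1.div_const P.η).const_mul (P.β₂₁ vs ε)).add
    ((s2.div_const 2).const_mul (P.lg / P.rg))).const_mul (P.β₃₂ / P.β₂₃)).add s3).const_mul
    (P.cc * P.β₄₃t / P.β₃₄)).add s4
  refine s5.congr_deriv ?_
  rw [mul_div_cancel_left₀ _ (two_ne_zero' ℝ)]
  rfl

theorem continuous_lyapunov (P : GridConverter) (vs : ℂ) (ε : ℝ) :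
    Continuous (P.lyapunov vs ε) := by
  have h := (P.planar vs).continuous_storage
  unfold lyapunov errors loopStorage iRef
  fun_prop

theorem contDiff_field (P : GridConverter) : ContDiff ℝ 1 P.field := by
  have h : ContDiff ℝ 1 fun x : ConverterState => ((‖x.vHat‖ ^ 2 : ℝ) : ℂ) :=
    Complex.ofRealCLM.contDiff.comp ((contDiff_norm_sq ℝ).comp contDiff_fst)
  have h1 : ContDiff ℝ 1 P.f₁ := by
    have : P.f₁ = fun x : ConverterState => I * (P.ωΔ : ℂ) * x.vHat
        + (P.η : ℂ) * P.sStar * x.vHat - (P.η : ℂ) * P.rot * x.iOut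
        + ((P.η * P.α : ℝ) : ℂ) * (1 / ((P.vStar ^ 2 : ℝ) : ℂ)) *
          (((P.vStar ^ 2 : ℝ) : ℂ) - ((‖x.vHat‖ ^ 2 : ℝ) : ℂ)) * x.vHat := by
      funext x
      simp only [f₁, ampReg]
      push_cast
      ring
    rw [this]
    fun_prop
  have h2 : ContDiff ℝ 1 P.f₂ := by unfold f₂; fun_prop
  have h3 : ContDiff ℝ 1 P.f₃ := by unfold f₃; fun_prop
  have h4 : ContDiff ℝ 1 P.f₄ := by unfold f₄ iRef; fun_prop
  unfold field
  fun_prop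

end GridConverter

/-! ### Decay of the composite Lyapunov function -/

namespace GridConverter

open ConverterState

namespace StabilityConditions

variable {P : GridConverter} {xs : ConverterState} {c₁ ε : ℝ}

theorem planar_a_nonneg (hP : P.Admissible) (vs : ℂ) : 0 ≤ (P.planar vs).a := by
  have := hP.α_nonneg
  simp only [planar]; positivity

theorem planar_c_pos {vs : ℂ} (hc : P.StabilityConditions vs c₁ ε) : 0 < (P.planar vs).c :=
  hc.c₁_pos.trans hc.c₁_lt_planar_c

theorem weights_pos (hP : P.Admissible) {vs : ℂ} (hc : P.StabilityConditions vs c₁ ε) :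
    0 < P.cc * P.β₄₃t / P.β₃₄ ∧ 0 < P.β₃₂ / P.β₂₃ ∧ 0 < P.β₂₁ vs ε := by
  have hkp := hP.kpv_pos
  have hkr := hP.krv_pos
  have hcf := hP.cf_pos
  have hη := hP.η_pos
  have hrg := hP.rg_pos
  have hcc := cc_pos hP
  have hγ := γ₄t_nonneg hP
  have hb34 : 0 < P.β₃₄ := by unfold β₃₄; positivity
  have hb43 : 0 < P.β₄₃t := by
    have : 0 ≤ P.γ₄t / P.β₃₄ := by positivity
    linarith [capGain_add_le hP, capGain_pos hP]
  refine ⟨by positivity, ?_, hc.β₂₁_pos hP⟩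
  unfold β₃₂ β₂₃ cv
  positivity

theorem exists_lyapunov_lower (hP : P.Admissible) {vs : ℂ}
    (hc : P.StabilityConditions vs c₁ ε) :
    ∃ k > 0, ∀ x, k * energy (P.errors vs x) ≤ P.lyapunov vs ε x := by
  obtain ⟨hw4, hw3, hw2⟩ := hc.weights_pos hP
  have ha := planar_a_nonneg hP vs
  have hpc := hc.planar_c_pos
  have hm := PlanarModel.m_pos ha hpc
  have hη := hP.η_pos
  have hrg := hP.rg_pos
  have hlg := hP.lg_pos
  obtain ⟨k3, hk3, h3⟩ := exists_loopStorage_lower hP.cf_pos hP.kpv_pos (hc.cf_lt_krv hP)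
  obtain ⟨k4, hk4, h4⟩ := exists_loopStorage_lower hP.lf_pos hP.kpc_pos (hc.lf_lt_krc hP)
  set w4 := P.cc * P.β₄₃t / P.β₃₄ with hw4'
  set w3 := P.β₃₂ / P.β₂₃ with hw3'
  set w2 := P.β₂₁ vs ε with hw2'
  set k1 := w4 * (w3 * (w2 * ((P.planar vs).m / 2 / P.η))) with hk1
  set k2 := w4 * (w3 * (P.lg / P.rg / 2)) with hk2
  have hk1' : 0 < k1 := by positivity
  have hk2' : 0 < k2 := by positivity
  set k := min (min k1 k2) (min (w4 * k3) k4) with hk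
  have hk0 : 0 < k := by rw [hk]; positivity
  have m1 : k ≤ k1 := (min_le_left _ _).trans (min_le_left _ _)
  have m2 : k ≤ k2 := (min_le_left _ _).trans (min_le_right _ _)
  have m3 : k ≤ w4 * k3 := (min_le_right _ _).trans (min_le_left _ _)
  have m4 : k ≤ k4 := (min_le_right _ _).trans (min_le_right _ _)
  refine ⟨k, hk0, fun x => ?_⟩
  set u := P.errors vs x with hu
  have e1 : k * ‖u.vHat‖ ^ 2 ≤ w4 * (w3 * (w2 * ((P.planar vs).storage u.vHat / P.η))) := by
    calc k * ‖u.vHat‖ ^ 2 ≤ k1 * ‖u.vHat‖ ^ 2 := by gcongr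
      _ = w4 * (w3 * (w2 * (((P.planar vs).m / 2 * ‖u.vHat‖ ^ 2) / P.η))) := by rw [hk1]; ring
      _ ≤ _ := by
        gcongr
        exact PlanarModel.storage_lower ha hpc _
  have e2 : k * ‖u.iOut‖ ^ 2 ≤ w4 * (w3 * (P.lg / P.rg * (‖u.iOut‖ ^ 2 / 2))) := by
    calc k * ‖u.iOut‖ ^ 2 ≤ k2 * ‖u.iOut‖ ^ 2 := by gcongr
      _ = _ := by rw [hk2]; ring
  have e3 : k * (‖u.vCap‖ ^ 2 + ‖u.ζv‖ ^ 2) ≤ w4 * loopStorage P.cf P.kpv P.krv u.vCap u.ζv := by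
    calc k * (‖u.vCap‖ ^ 2 + ‖u.ζv‖ ^ 2) ≤ w4 * k3 * (‖u.vCap‖ ^ 2 + ‖u.ζv‖ ^ 2) := by gcongr
      _ = w4 * (k3 * (‖u.vCap‖ ^ 2 + ‖u.ζv‖ ^ 2)) := by ring
      _ ≤ _ := by
        gcongr
        exact h3 _ _
  have e4 : k * (‖u.iInd‖ ^ 2 + ‖u.ζc‖ ^ 2) ≤ loopStorage P.lf P.kpc P.krc u.iInd u.ζc := by
    refine le_trans ?_ (h4 _ _)
    gcongr
  change k * energy u ≤ w4 * (w3 * (w2 * ((P.planar vs).storage u.vHat / P.η)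
    + P.lg / P.rg * (‖u.iOut‖ ^ 2 / 2)) + loopStorage P.cf P.kpv P.krv u.vCap u.ζv)
    + loopStorage P.lf P.kpc P.krc u.iInd u.ζc
  unfold energy
  linarith

theorem exists_lyapunovDeriv_le (hP : P.Admissible) (hω : P.ωΔ = 0) (hxs : P.field xs = 0)
    (hc : P.StabilityConditions xs.vHat c₁ ε) :
    ∃ k > 0, ∀ x, P.lyapunovDeriv xs.vHat ε x (P.field x)
      ≤ -k * energy (P.errors xs.vHat x) := by
  obtain ⟨k, hk, hrate⟩ := hc.exists_rate hP
  have ha := planar_a_nonneg hP xs.vHat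
  have hpc := hc.planar_c_pos
  have hm := PlanarModel.m_pos ha hpc
  have hη := hP.η_pos
  have hrg := hP.rg_pos
  have hlg := hP.lg_pos
  have hcf := hP.cf_pos
  have hkp := hP.kpv_pos
  have hcε := hc.cε_pos hP
  have hcc := cc_pos hP
  set M := P.planar xs.vHat with hM
  -- The rate is in terms of `ψ₁`, which dominates `m ‖δ‖`; the other magnitudes are the error norms
  -- themselves.
  refine ⟨k * min 1 (M.m ^ 2), by positivity, fun x => ?_⟩
  set u := P.errors xs.vHat x with hu
  obtain ⟨hG, hF, hδ⟩ := PlanarModel.dissipation ha hpc u.vHat (hc.planar_norm_le hP)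
  set G := M.grad u.vHat
  set Fδ := M.F u.vHat
  set ip := inner ℝ G Fδ with hip
  have hip0 : 0 ≤ ip := le_trans (by positivity) hG
  -- Taking the dissipation itself as magnitude bounds the gradient and the field at once, whatever
  -- the size of `δ`.
  set ψ₁ := √(ip / M.c) with hψ₁
  have hψ₁2 : ψ₁ ^ 2 = ip / M.c := Real.sq_sqrt (by positivity)
  have hip_eq : ip = M.c * ψ₁ ^ 2 := by rw [hψ₁2]; field_simp
  have hGψ2 : ‖G‖ ^ 2 ≤ ψ₁ ^ 2 := by
    rw [hψ₁2, le_div_iff₀ hpc]; linarith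
  have hψ₁0 : 0 ≤ ψ₁ := Real.sqrt_nonneg _
  have hGψ : ‖G‖ ≤ ψ₁ := le_of_sq_le_sq hGψ2 hψ₁0
  have hFψ : ‖Fδ‖ ≤ P.cε xs.vHat ε * ψ₁ := by
    refine le_of_sq_le_sq ?_ (by positivity)
    rw [mul_pow, hψ₁2, ← mul_div_assoc, le_div_iff₀ hpc]
    linarith
  set ψ₃ := √(‖u.vCap‖ ^ 2 + ‖u.ζv‖ ^ 2) with hψ₃
  set ψ₄ := √(‖u.iInd‖ ^ 2 + ‖u.ζc‖ ^ 2) with hψ₄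
  have hψ₃2 : ψ₃ ^ 2 = ‖u.vCap‖ ^ 2 + ‖u.ζv‖ ^ 2 := Real.sq_sqrt (by positivity)
  have hψ₄2 : ψ₄ ^ 2 = ‖u.iInd‖ ^ 2 + ‖u.ζc‖ ^ 2 := Real.sq_sqrt (by positivity)
  have hψ₃0 : 0 ≤ ψ₃ := Real.sqrt_nonneg _
  have hψ₄0 : 0 ≤ ψ₄ := Real.sqrt_nonneg _
  have hrot : ‖P.rot‖ = 1 := by
    rw [rot, mul_comm]; exact Complex.norm_exp_ofReal_mul_I _
  have hf₁ := f₁_eq hP hω hxs x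
  rw [← hu, ← hM] at hf₁
  have hrest : ‖P.rot * u.iOut‖ = ‖u.iOut‖ := by rw [norm_mul, hrot, one_mul]
  have hf₁' : P.f₁ x = P.η • (-(Fδ + P.rot * u.iOut)) := by
    rw [hf₁, Complex.real_smul]; ring
  have hv : ‖P.f₁ x‖ ≤ P.η * (P.cε xs.vHat ε * ψ₁ + ‖u.iOut‖) := by
    rw [hf₁', norm_smul, norm_neg, Real.norm_of_nonneg hη.le]
    gcongr
    refine (norm_add_le _ _).trans ?_
    rw [hrest]
    gcongr
  have v1 : inner ℝ G (P.f₁ x) / P.η ≤ -c₁ * ψ₁ ^ 2 + ψ₁ * ‖u.iOut‖ := by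
    rw [hf₁', real_inner_smul_right, mul_div_cancel_left₀ _ hη.ne', inner_neg_right,
      inner_add_right, ← hip, hip_eq]
    have h1 := (abs_le.1 (abs_real_inner_le_norm G (P.rot * u.iOut))).1
    rw [hrest] at h1
    have h2 : ‖G‖ * ‖u.iOut‖ ≤ ψ₁ * ‖u.iOut‖ := by gcongr
    have h3 : c₁ * ψ₁ ^ 2 ≤ M.c * ψ₁ ^ 2 := by
      gcongr
      exact hc.c₁_lt_planar_c.le
    linarith
  have hvcap : ‖u.vCap‖ ≤ ψ₃ := Real.le_sqrt_of_sq_le (by linarith [sq_nonneg ‖u.ζv‖])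
  have hwind : ‖u.iInd‖ ≤ ψ₄ := Real.le_sqrt_of_sq_le (by linarith [sq_nonneg ‖u.ζc‖])
  have v2 : P.lg / P.rg * inner ℝ u.iOut (P.f₂ x - P.y * P.f₁ x)
      ≤ -‖u.iOut‖ ^ 2 + 1 / P.rg * ‖u.iOut‖ * ψ₃
        + P.lg / P.rg * ‖P.y‖ * ‖u.iOut‖ * (P.η * (P.cε xs.vHat ε * ψ₁ + ‖u.iOut‖)) := by
    have hz : inner ℝ u.iOut (P.z * u.iOut) = P.rg * ‖u.iOut‖ ^ 2 := by
      rw [← one_mul u.iOut, ← mul_assoc, mul_one, inner_mul_mul_right]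
      simp [z]
    have h2 : P.f₂ x = P.lg⁻¹ • (u.vCap - P.z * u.iOut) := by
      rw [f₂_eq hP xs.vHat, ← hu, Complex.real_smul, Complex.ofReal_inv]; ring
    rw [inner_sub_right, h2, real_inner_smul_right, inner_sub_right, hz]
    have h3 : inner ℝ u.iOut u.vCap ≤ ‖u.iOut‖ * ψ₃ :=
      (real_inner_le_norm _ _).trans (by gcongr)
    have h4 : -inner ℝ u.iOut (P.y * P.f₁ x)
        ≤ ‖P.y‖ * ‖u.iOut‖ * (P.η * (P.cε xs.vHat ε * ψ₁ + ‖u.iOut‖)) := by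
      have h5 := (abs_le.1 (abs_real_inner_le_norm u.iOut (P.y * P.f₁ x))).1
      rw [norm_mul] at h5
      have h6 : ‖u.iOut‖ * (‖P.y‖ * ‖P.f₁ x‖) ≤ ‖u.iOut‖ * (‖P.y‖ *
        (P.η * (P.cε xs.vHat ε * ψ₁ + ‖u.iOut‖))) := by gcongr
      linarith
    calc P.lg / P.rg * (P.lg⁻¹ * (inner ℝ u.iOut u.vCap - P.rg * ‖u.iOut‖ ^ 2)
          - inner ℝ u.iOut (P.y * P.f₁ x))
        = -‖u.iOut‖ ^ 2 + 1 / P.rg * inner ℝ u.iOut u.vCap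
          + P.lg / P.rg * -inner ℝ u.iOut (P.y * P.f₁ x) := by field_simp; ring
      _ ≤ -‖u.iOut‖ ^ 2 + 1 / P.rg * (‖u.iOut‖ * ψ₃) + P.lg / P.rg *
          (‖P.y‖ * ‖u.iOut‖ * (P.η * (P.cε xs.vHat ε * ψ₁ + ‖u.iOut‖))) := by gcongr
      _ = _ := by ring
  have v3 : loopStorageDeriv P.cf P.kpv P.krv u.vCap u.ζv ((P.f₃ x).1 - P.f₁ x) (P.f₃ x).2
      ≤ -P.α₃ * ψ₃ ^ 2
        + P.cv * ψ₃ * (ψ₄ / P.cf + P.η * (P.cε xs.vHat ε * ψ₁ + ‖u.iOut‖)) := by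
    have h1 := loopStorageDeriv_le hcf hkp hP.krv_pos u.vCap u.ζv
      ((P.cf : ℂ)⁻¹ * u.iInd - P.f₁ x)
    have h2 : ‖(P.cf : ℂ)⁻¹ * u.iInd - P.f₁ x‖
        ≤ ψ₄ / P.cf + P.η * (P.cε xs.vHat ε * ψ₁ + ‖u.iOut‖) := by
      refine (norm_sub_le _ _).trans (add_le_add ?_ hv)
      rw [norm_mul, norm_inv, Complex.norm_of_nonneg hcf.le, mul_comm, ← div_eq_mul_inv]
      gcongr
    have hcv : 0 ≤ P.cv * ψ₃ := by
      have := hP.krv_pos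
      unfold cv; positivity
    rw [f₃_eq hω xs.vHat, ← hu, hψ₃2]
    have h3 : (P.cf : ℂ)⁻¹ * (-(P.kpv : ℂ) * u.vCap - (P.krv : ℂ) * u.ζv + u.iInd) - P.f₁ x
        = (P.cf : ℂ)⁻¹ * (-(P.kpv : ℂ) * u.vCap - (P.krv : ℂ) * u.ζv)
          + ((P.cf : ℂ)⁻¹ * u.iInd - P.f₁ x) := by ring
    simp only [h3]
    exact h1.trans (add_le_add le_rfl (mul_le_mul_of_nonneg_left h2 hcv))
  have v4 : loopStorageDeriv P.lf P.kpc P.krc u.iInd u.ζc ((P.f₄ x).1 - P.iRef (P.field x))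
      (P.f₄ x).2 ≤ -(1 - P.lf / P.krc) * ψ₄ ^ 2 + P.cc * ψ₄ * (P.β₄₁t xs.vHat ε * ψ₁
        + P.β₄₂t * ‖u.iOut‖ + P.capGain * ψ₃ + P.γ₄t * ψ₄) := by
    have h1 := loopStorageDeriv_le hP.lf_pos hP.kpc_pos hP.krc_pos u.iInd u.ζc
      (-P.iRef (P.field x))
    have h2 : ‖-P.iRef (P.field x)‖ ≤ P.β₄₁t xs.vHat ε * ψ₁ + P.β₄₂t * ‖u.iOut‖
        + P.capGain * ψ₃ + P.γ₄t * ψ₄ := by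
      rw [norm_neg]
      have h3 := norm_iRef_field_le hP hω xs.vHat x
      rw [← hu, ← hψ₃] at h3
      have h4 := mul_le_mul_of_nonneg_left hv hkp.le
      have h5 := mul_le_mul_of_nonneg_left hwind (γ₄t_nonneg hP)
      have h6 : P.kpv * (P.η * (P.cε xs.vHat ε * ψ₁ + ‖u.iOut‖)) + ‖P.z‖ / P.lg * ‖u.iOut‖
          = P.β₄₁t xs.vHat ε * ψ₁ + P.β₄₂t * ‖u.iOut‖ := by unfold β₄₁t β₄₂t; ring
      linarith
    rw [f₄_eq hω xs.vHat, ← hu, hψ₄2]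
    rw [← sub_eq_add_neg] at h1
    exact h1.trans (add_le_add le_rfl
      (mul_le_mul_of_nonneg_left h2 (mul_nonneg hcc.le hψ₄0)))
  have htotal := hrate ψ₁ ‖u.iOut‖ ψ₃ ψ₄ _ _ _ _ hψ₁0 (norm_nonneg _) hψ₃0 hψ₄0 v1 v2 v3 v4
  refine htotal.trans ?_
  rw [neg_mul, neg_mul, neg_le_neg_iff, mul_assoc]
  refine mul_le_mul_of_nonneg_left ?_ hk.le
  have hmin1 : min 1 (M.m ^ 2) ≤ 1 := min_le_left _ _
  have e1 : min 1 (M.m ^ 2) * ‖u.vHat‖ ^ 2 ≤ ψ₁ ^ 2 :=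
    (mul_le_mul_of_nonneg_right (min_le_right _ _) (sq_nonneg _)).trans (hδ.trans hGψ2)
  have e2 := mul_le_of_le_one_left (sq_nonneg ‖u.iOut‖) hmin1
  have e3 := mul_le_of_le_one_left (sq_nonneg ψ₃) hmin1
  have e4 := mul_le_of_le_one_left (sq_nonneg ψ₄) hmin1
  unfold energy
  rw [← hψ₃2, ← hψ₄2]
  linarith

/-- Under the stability conditions the full-order system has a global strict Lyapunov function. -/
theorem exists_isStrictLyapunov (hP : P.Admissible) (hω : P.ωΔ = 0) (hxs : P.field xs = 0)
    (hc : P.StabilityConditions xs.vHat c₁ ε) :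
    ∃ k k', IsStrictLyapunov P.field xs (P.lyapunov xs.vHat ε)
      (P.lyapunovDeriv xs.vHat ε) k k' := by
  obtain ⟨k, hk, hlow⟩ := hc.exists_lyapunov_lower hP
  obtain ⟨k', hk', hdec⟩ := hc.exists_lyapunovDeriv_le hP hω hxs
  have he := equilibrium_relations hP hω hxs
  have hnorm := norm_sub_sq_le he
  set C := ‖P.ofErrors‖ ^ 2 + 1
  have hC : 0 < C := by positivity
  refine ⟨k / C, k' / C, ⟨by positivity, by positivity, P.continuous_lyapunov _ _, ?_, fun x => ?_,
    fun γ w s t h => P.hasDerivWithinAt_lyapunov _ _ h, fun x w r => P.lyapunovDeriv_smul _ _ _ _ _,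
    fun x => ?_⟩⟩
  · simp only [lyapunov, he]
    simp [PlanarModel.storage_zero, loopStorage, show iOut (0 : ConverterState) = 0 from rfl,
      show vCap (0 : ConverterState) = 0 from rfl, show ζv (0 : ConverterState) = 0 from rfl,
      show iInd (0 : ConverterState) = 0 from rfl, show ζc (0 : ConverterState) = 0 from rfl]
  · refine le_trans ?_ (hlow x)
    rw [div_mul_eq_mul_div, div_le_iff₀ hC]
    nlinarith [mul_le_mul_of_nonneg_left (hnorm x) hk.le]
  · refine (hdec x).trans ?_
    rw [neg_mul, neg_mul, neg_le_neg_iff, div_mul_eq_mul_div, div_le_iff₀ hC]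
    nlinarith [mul_le_mul_of_nonneg_left (hnorm x) hk'.le]

end StabilityConditions

end GridConverter

/-! ### The radius equation and the main theorem -/

/-- For `ε > 3` the equation `((1 + t)³ - 1) / t = ε` has a positive solution. -/
theorem exists_pos_cube_quotient_eq {ε : ℝ} (hε : 3 < ε) :
    ∃ t : ℝ, 0 < t ∧ ((1 + t) ^ 3 - 1) / t = ε := by
  have hs : √(4 * ε - 3) ^ 2 = 4 * ε - 3 := Real.sq_sqrt (by linarith)
  have h3 : 3 < √(4 * ε - 3) := (Real.lt_sqrt (by norm_num)).2 (by linarith)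
  have ht : 0 < (√(4 * ε - 3) - 3) / 2 := by linarith
  -- After division by `t` the equation is `t² + 3t + 3 = ε`, and the witness is its larger root.
  refine ⟨_, ht, ?_⟩
  rw [div_eq_iff ht.ne']
  linear_combination ((√(4 * ε - 3) - 3) / 8) * hs

theorem mainTheorem3 (P : GridConverter) (hP : P.Admissible) (hω : P.ωΔ = 0)
    (xs : ConverterState) (hxs : P.field xs = 0)
    (c₁ ε : ℝ) (hc : P.StabilityConditions xs.vHat c₁ ε) :
    AsymptoticallyStable P.field xs ∧
    (xs.vHat ≠ 0 → ∃ r : ℝ, 0 < r ∧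
      ((1 + r / ‖xs.vHat‖) ^ 3 - 1) / (r / ‖xs.vHat‖) = ε ∧
      {x : ConverterState | ‖x.vHat - xs.vHat‖ < r} ⊆ regionOfAttraction P.field xs) := by
  obtain ⟨k, k', hV⟩ := hc.exists_isStrictLyapunov hP hω hxs
  have hroa := hV.regionOfAttraction_eq_univ P.contDiff_field
  refine ⟨⟨hxs, hV.lyapunovStable P.contDiff_field, by rw [hroa]; exact univ_mem⟩, fun hv => ?_⟩
  obtain ⟨t, ht, heq⟩ := exists_pos_cube_quotient_eq hc.three_lt_ε
  have hn : 0 < ‖xs.vHat‖ := norm_pos_iff.2 hv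
  refine ⟨t * ‖xs.vHat‖, by positivity, ?_, by rw [hroa]; exact subset_univ _⟩
  rwa [mul_div_cancel_right₀ _ hn.ne']
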